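/- Let $d\ge 1$ and $n>3$ be integers, let $\mu$ be a Borel measure on $\mathbb{R}^d$ with $\mu([0,1]^d)=1$, and put $A=[0,1]^{2d}=[0,1]^d\times[0,1]^d$. Let $(X_i)_{i\ge 0}$ be a time-homogeneous Markov chain on a probability space, with values in $\mathbb{R}^d$ and transition density $s$ with respect to $\mu$: $s\ge 0$ is measurable on $\mathbb{R}^d\times\mathbb{R}^d$, $\int s(x,y)\,d\mu(y)=1$ for every $x$, and conditionally on $X_0,\dots,X_i$ the law of $X_{i+1}$ is $s(X_i,y)\,d\mu(y)$. Nothing else is assumed on the chain. For nonnegative functions $f,f'$ on $\mathbb{R}^{2d}$ set $$H^2(f,f')=\frac1{2n}\sum_{i=0}^{n-1}\int\Big(\sqrt{f(X_i,y)}-\sqrt{f'(X_i,y)}\Big)^2d\mu(y),$$ $$T(f,f')=\frac{1}{2n\sqrt2}\sum_{i=0}^{n-1}\int\sqrt{f(X_i,y)+f'(X_i,y)}\Big(\sqrt{f'(X_i,y)}-\sqrt{f(X_i,y)}\Big)d\mu(y)+\frac1{n\sqrt2}\sum_{i=0}^{n-1}\frac{\sqrt{f'(X_i,X_{i+1})}-\sqrt{f(X_i,X_{i+1})}}{\sqrt{f(X_i,X_{i+1})+f'(X_i,X_{i+1})}}+\frac1{2n}\sum_{i=0}^{n-1}\int\big(f(X_i,y)-f'(X_i,y)\big)d\mu(y),$$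 with $0/0=0$, and let $H^2(f,V)=\inf_{g\in V}H^2(f,g)$ for a set $V$ of such functions. For $j\ge0$ let $\mathcal K_j$ be the set of the $4^{jd}$ dyadic cubes $\prod_{i=1}^{2d}I_j(l_i)$, $1\le l_i\le 2^j$, where $I_j(l)=[\frac{l-1}{2^j},\frac{l}{2^j})$ if $l<2^j$ and $I_j(2^j)=[1-2^{-j},1]$. For $\ell\in\mathbb{N}^\star$ let $\mathcal M_\ell$ be the set of all partitions of $A$ that are obtained from $\{A\}$ in at most $\ell$ steps, where one step replaces some (possibly none) of the cubes $K\in\mathcal K_j$ of the current partition by the $4^d$ cubes of $\mathcal K_{j+1}$ contained in $K$; let $\mathcal M_\infty=\bigcup_{\ell\ge1}\mathcal M_\ell$. For $m\in\mathcal M_\infty$ let $V_m=\{\sum_{K\in m}a_K\mathbf 1_K:\ a_K\ge 0\}$ and $$\hat s_m=\sum_{K\in m}\frac{\sum_{i=0}^{n-1}\mathbf 1_K(X_i,X_{i+1})}{\sum_{i=0}^{n-1}\int_{[0,1]^d}\mathbf 1_K(X_i,x)\,d\mu(x)}\,\mathbf 1_K ,$$ a quotient with denominator $0$ being $0$. For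 a set $K$ let $m\vee K=\{K'\cap K:\ K'\in m,\ K'\cap K\ne\emptyset\}$. For $L>0$ and a finite collection $m$ of sets let $\mathrm{pen}(m)=L|m|\log n/n$. Let $\alpha=(1-1/\sqrt2)/2$. For $L>0$, $\ell\in\mathbb{N}^\star\cup\{\infty\}$ and $m\in\mathcal M_\ell$ put $$\gamma(m)=\sum_{K\in m}\ \sup_{m'\in\mathcal M_\ell}\Big[\sum_{K'\in m'}\Big(\alpha H^2(\hat s_m\mathbf 1_{K\cap K'},\hat s_{m'}\mathbf 1_{K\cap K'})+T(\hat s_m\mathbf 1_{K\cap K'},\hat s_{m'}\mathbf 1_{K\cap K'})\Big)-\mathrm{pen}(m'\vee K)\Big]+2\,\mathrm{pen}(m),$$ let $\hat m$ be any (measurable) random element of $\mathcal M_\ell$ with $\gamma(\hat m)\le\inf_{m\in\mathcal M_\ell}\gamma(m)+1/n$, and let $\hat s=\hat s(L,\ell)=\hat s_{\hat m}$. Theorem. There are universal constants $L_0>0$ and $C>0$ (depending on none of the quantities above) such that, in the above setting, for all $L\ge L_0$, all $\ell\in\mathbb{N}^\star\cup\{\infty\}$ and every such choice of $\hat m$,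 the loss $H^2(s\mathbf 1_A,\hat s)$ is integrable and $$C\,\mathbb E\big[H^2(s\mathbf 1_A,\hat s)\big]\le\inf_{m\in\mathcal M_\ell}\Big\{\mathbb E\big[H^2(s\mathbf 1_A,V_m)\big]+\mathrm{pen}(m)\Big\}.$$ -/

import Mathlib

open MeasureTheory

noncomputable section

namespace TransitionDensity

/-- `ℝ^{2d}`, written as `ℝ^d × ℝ^d`: the first factor carries the current state of the chain,
the second one the next state. -/
abbrev Pair (d : ℕ) : Type := (Fin d → ℝ) × (Fin d → ℝ)

/-- The cube `[0,1]^d`. -/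
def unitCube (d : ℕ) : Set (Fin d → ℝ) := Set.Icc 0 1

/-- The set `A = [0,1]^{2d}`. -/
def unitSquare (d : ℕ) : Set (Pair d) := unitCube d ×ˢ unitCube d

/-- `(X i)` is a time-homogeneous Markov chain with values in `ℝ^d` whose transition density with
respect to `μ` is `s`: conditionally on `X 0, …, X i`, the law of `X (i+1)` is
`s (X i, y) μ(dy)`. -/
structure IsMarkovChain {Ω : Type*} [MeasurableSpace Ω] (P : Measure Ω) {d : ℕ}
    (μ : Measure (Fin d → ℝ)) (s : Pair d → ℝ) (X : ℕ → Ω → (Fin d → ℝ)) : Prop where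
  measurable_chain : ∀ i, Measurable (X i)
  measurable_density : Measurable s
  density_nonneg : ∀ p, 0 ≤ s p
  lintegral_density : ∀ x, ∫⁻ y, ENNReal.ofReal (s (x, y)) ∂μ = 1
  markov : ∀ (i : ℕ) (B : Set (Fin d → ℝ)), MeasurableSet B →
    P[(X (i + 1) ⁻¹' B).indicator (fun _ => (1 : ℝ)) |
        ⨆ (j : ℕ) (_ : j ≤ i), MeasurableSpace.comap (X j) inferInstance]
      =ᵐ[P] fun ω => ∫ y in B, s (X i ω, y) ∂μ

/-! ### Dyadic partitions of `[0,1]^{2d}` -/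

/-- The interval `I_j(l)`, for `1 ≤ l ≤ 2^j`. -/
def dyadicInterval (j l : ℕ) : Set ℝ :=
  if l < 2 ^ j then Set.Ico (((l : ℝ) - 1) / 2 ^ j) ((l : ℝ) / 2 ^ j)
  else Set.Icc (((l : ℝ) - 1) / 2 ^ j) 1

/-- The cube `K_{j,l} = ∏ I_j(l_i)`; the `2d` coordinates are indexed by `Fin d ⊕ Fin d`. -/
def dyadicCube {d : ℕ} (j : ℕ) (l : Fin d ⊕ Fin d → ℕ) : Set (Pair d) :=
  {p | (∀ i, p.1 i ∈ dyadicInterval j (l (Sum.inl i))) ∧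
    ∀ i, p.2 i ∈ dyadicInterval j (l (Sum.inr i))}

open Classical in
/-- The collection `𝒦_j` of all dyadic cubes of side length `2^{-j}`. -/
def dyadicCubes (d j : ℕ) : Finset (Set (Pair d)) :=
  (Fintype.piFinset fun _ : Fin d ⊕ Fin d => Finset.Icc 1 (2 ^ j)).image (dyadicCube j)

open Classical in
/-- One step of the algorithm: some of the cubes of `m` (those in `D`) are divided, a cube of
`𝒦_j` being divided into the elements of `𝒦_{j+1}` that it contains. -/
def IsStep {d : ℕ} (m m' : Finset (Set (Pair d))) : Prop :=
  ∃ D ⊆ m, ∃ j : Set (Pair d) → ℕ, (∀ K ∈ D, K ∈ dyadicCubes d (j K)) ∧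
    m' = (m \ D) ∪ D.biUnion fun K => (dyadicCubes d (j K + 1)).filter fun K' => K' ⊆ K

/-- The partitions obtained after `k` steps of the algorithm. As a step may divide nothing,
these are those that can be constructed in at most `k` steps. -/
def partitionsAfter (d : ℕ) : ℕ → Set (Finset (Set (Pair d)))
  | 0 => {{unitSquare d}}
  | k + 1 => {m' | ∃ m ∈ partitionsAfter d k, IsStep m m'}

/-- The collection `𝓜_ℓ`, for `ℓ` finite or infinite. -/
def partitions (d : ℕ) (ℓ : ℕ∞) : Set (Finset (Set (Pair d))) :=
  {m | ∃ k : ℕ, (k : ℕ∞) ≤ ℓ ∧ m ∈ partitionsAfter d k}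

open Classical in
/-- The partition `m' ∨ K` of `K`. -/
def join {d : ℕ} (m' : Finset (Set (Pair d))) (K : Set (Pair d)) : Finset (Set (Pair d)) :=
  (m'.filter fun K' => (K' ∩ K).Nonempty).image fun K' => K' ∩ K

/-! ### Loss, estimators and selection rule, as functions of the observed path `x` -/

/-- The squared random Hellinger distance `H²(f, g)`. -/
def hellingerSq {d : ℕ} (μ : Measure (Fin d → ℝ)) (n : ℕ) (x : ℕ → (Fin d → ℝ))
    (f g : Pair d → ℝ) : ℝ :=
  1 / (2 * (n : ℝ)) *
    ∑ i ∈ Finset.range n, ∫ y, (Real.sqrt (f (x i, y)) - Real.sqrt (g (x i, y))) ^ 2 ∂μ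

/-- The set `V_m` of nonnegative functions that are piecewise constant on `m`. -/
def histograms {d : ℕ} (m : Finset (Set (Pair d))) : Set (Pair d → ℝ) :=
  {f | ∃ a : Set (Pair d) → ℝ, (∀ K ∈ m, 0 ≤ a K) ∧
    f = fun p => ∑ K ∈ m, a K * K.indicator (fun _ => (1 : ℝ)) p}

/-- `H²(f, V) = inf_{g ∈ V} H²(f, g)`. -/
def hellingerSqDist {d : ℕ} (μ : Measure (Fin d → ℝ)) (n : ℕ) (x : ℕ → (Fin d → ℝ))
    (f : Pair d → ℝ) (V : Set (Pair d → ℝ)) : ℝ :=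
  ⨅ g : V, hellingerSq μ n x f g

/-- The histogram estimator `ŝ_m` (with `a / 0 = 0`). -/
def histogramEstimator {d : ℕ} (μ : Measure (Fin d → ℝ)) (n : ℕ) (x : ℕ → (Fin d → ℝ))
    (m : Finset (Set (Pair d))) : Pair d → ℝ := fun p =>
  ∑ K ∈ m,
    (∑ i ∈ Finset.range n, K.indicator (fun _ => (1 : ℝ)) (x i, x (i + 1))) /
      (∑ i ∈ Finset.range n, ∫ y in unitCube d, K.indicator (fun _ => (1 : ℝ)) (x i, y) ∂μ) *
      K.indicator (fun _ => (1 : ℝ)) p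

/-- The test functional `T(f, g)` (with `0 / 0 = 0`). -/
def testT {d : ℕ} (μ : Measure (Fin d → ℝ)) (n : ℕ) (x : ℕ → (Fin d → ℝ))
    (f g : Pair d → ℝ) : ℝ :=
  1 / (2 * (n : ℝ) * Real.sqrt 2) *
      ∑ i ∈ Finset.range n, ∫ y, Real.sqrt (f (x i, y) + g (x i, y)) *
        (Real.sqrt (g (x i, y)) - Real.sqrt (f (x i, y))) ∂μ
    + 1 / ((n : ℝ) * Real.sqrt 2) *
      ∑ i ∈ Finset.range n,
        (Real.sqrt (g (x i, x (i + 1))) - Real.sqrt (f (x i, x (i + 1)))) /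
          Real.sqrt (f (x i, x (i + 1)) + g (x i, x (i + 1)))
    + 1 / (2 * (n : ℝ)) *
      ∑ i ∈ Finset.range n, ∫ y, (f (x i, y) - g (x i, y)) ∂μ

/-- The penalty `pen(m) = L |m| log n / n`. -/
def pen {d : ℕ} (L : ℝ) (n : ℕ) (m : Finset (Set (Pair d))) : ℝ :=
  L * ((m.card : ℝ) * Real.log n / n)

/-- The constant `α = (1 - 1/√2)/2`. -/
def alpha : ℝ := (1 - 1 / Real.sqrt 2) / 2

/-- The criterion `γ(m)`. -/
def criterion {d : ℕ} (μ : Measure (Fin d → ℝ)) (n : ℕ) (L : ℝ) (ℓ : ℕ∞)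
    (x : ℕ → (Fin d → ℝ)) (m : Finset (Set (Pair d))) : ℝ :=
  (∑ K ∈ m, ⨆ m' : partitions d ℓ,
    ((∑ K' ∈ m'.1,
        (alpha * hellingerSq μ n x
            ((K ∩ K').indicator (histogramEstimator μ n x m))
            ((K ∩ K').indicator (histogramEstimator μ n x m'.1))
          + testT μ n x
            ((K ∩ K').indicator (histogramEstimator μ n x m))
            ((K ∩ K').indicator (histogramEstimator μ n x m'.1))))
      - pen L n (join m'.1 K)))
    + 2 * pen L n m

/-- The random partition `mhat` is an admissible choice of `m̂` in `𝓜_ℓ` based on the observations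
`X 0, …, X n`. -/
structure IsSelected {Ω : Type*} [MeasurableSpace Ω] {d : ℕ} (μ : Measure (Fin d → ℝ)) (n : ℕ)
    (L : ℝ) (ℓ : ℕ∞) (X : ℕ → Ω → (Fin d → ℝ)) (mhat : Ω → Finset (Set (Pair d))) : Prop where
  mem : ∀ ω, mhat ω ∈ partitions d ℓ
  measurableSet_eq : ∀ m ∈ partitions d ℓ, MeasurableSet {ω | mhat ω = m}
  criterion_le : ∀ ω, criterion μ n L ℓ (fun i => X i ω) (mhat ω) ≤
    (⨅ m : partitions d ℓ, criterion μ n L ℓ (fun i => X i ω) m.1) + 1 / (n : ℝ)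

end TransitionDensity

end

/-! For a cell K, let D, R and S be the sums over i < n of the integrals of 1, √s and s over the
section of K at X_i, and let N be the number of observed transitions in K. A histogram with value a
on K loses S - 2√a R + aD there, so the loss, the estimators N/D and the test are explicit in D, R,
S, N. Randomness enters only through the gap between N and its compensator S. On a good event the
oracle inequality is therefore deterministic.

The good event (`IsGoodPath`) asks, in every dyadic cube of level at most 2n, that |N - S| ≤ S/k +
4k log n for all 1 ≤ k ≤ n, a Bernstein bound with free trade-off k. A plain union bound over
exponentially many cubes is too costly. Instead, functionals such as (e^{lN} - 1)e^{-cS} are used: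
they vanish when N = S = 0 and their expectation is at most c E[S] (`drift_upper`, `drift_lower`,
`integral_functional_le`). The cubes of one level are disjoint, so their compensators sum to at most
n, and the union bound costs a factor n whatever the number of cubes (`measureReal_exists_le`). The
good event fails with probability at most 24/n.

Two facts carry the deterministic part. If p, q, σ are the square roots of two candidate values and
of s, the integrand of αH² + T, after replacing the counting measure by its compensator, is at most
2(σ-p)² - (σ-q)²/60, with room to absorb a noise term (`pointwise_test_le`). This is a quadratic
inequality in σ, so it passes to D, R, S (`IsMomentTriple`, `cellTest_le`). Also, T is
antisymmetric, so the score of the selected partition against m is bounded below by minus the score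
of m against it (`criterion_ge`). With γ(m) bounded above on good paths (`IsGoodPath.criterion_le`),
the near-minimality of the selected partition yields the inequality; the penalty constant is large
enough for the terms in |m̂| to cancel favourably. On each cell N/D is nearly as good as the best
constant (`cellLoss_estimator_le`).

Levels up to 2n suffice even when ℓ = ∞. A deep cube forces many pieces (`le_add_card_join`), and a
partition cutting a cell into more than n pieces has a penalty there exceeding any possible score.
Off the good event the loss is at most 1, and 24/n is below pen(m). -/

noncomputable section

namespace TransitionDensity

/-! ### Geometry of dyadic cubes -/

/-- The label `l` of the dyadic interval of level `j` that contains `t ∈ [0,1]`. -/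
def dyadicIndex (j : ℕ) (t : ℝ) : ℕ := min (⌊t * 2 ^ j⌋₊ + 1) (2 ^ j)

lemma one_le_dyadicIndex (j : ℕ) (t : ℝ) : 1 ≤ dyadicIndex j t :=
  le_min (Nat.le_add_left _ _) Nat.one_le_two_pow

lemma dyadicIndex_le (j : ℕ) (t : ℝ) : dyadicIndex j t ≤ 2 ^ j := min_le_right _ _

lemma mem_dyadicInterval_iff {j l : ℕ} (h1 : 1 ≤ l) (h2 : l ≤ 2 ^ j) {t : ℝ} :
    t ∈ dyadicInterval j l ↔ t ∈ Set.Icc (0 : ℝ) 1 ∧ dyadicIndex j t = l := by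
  obtain ⟨k, rfl⟩ : ∃ k, l = k + 1 := ⟨l - 1, by omega⟩
  have hp : (0 : ℝ) < 2 ^ j := by positivity
  have hk : (((k + 1 : ℕ) : ℝ) - 1) = k := by push_cast; ring
  unfold dyadicInterval dyadicIndex
  rw [hk]
  split_ifs with h
  · rw [Set.mem_Ico, div_le_iff₀ hp, lt_div_iff₀ hp, Set.mem_Icc]
    have hkR : (((k + 1 : ℕ) : ℝ)) < 2 ^ j := by exact_mod_cast h
    constructor
    · rintro ⟨ha, hb⟩
      have ht0 : 0 ≤ t := by
        by_contra hc
        have : t * 2 ^ j < 0 := mul_neg_of_neg_of_pos (not_le.mp hc) hp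
        have : (0 : ℝ) ≤ k := Nat.cast_nonneg k
        linarith
      have hfl : ⌊t * 2 ^ j⌋₊ = k := by
        rw [Nat.floor_eq_iff (by positivity)]
        exact ⟨ha, by push_cast at hb; exact hb⟩
      refine ⟨⟨ht0, ?_⟩, by rw [hfl]; omega⟩
      by_contra hc
      nlinarith [not_le.mp hc]
    · rintro ⟨⟨h0, h1⟩, he⟩
      have hfl : ⌊t * 2 ^ j⌋₊ = k := by omega
      rw [Nat.floor_eq_iff (by positivity)] at hfl
      exact ⟨hfl.1, by push_cast; exact hfl.2⟩
  · have hj : 2 ^ j = k + 1 := by omega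
    rw [Set.mem_Icc, div_le_iff₀ hp, Set.mem_Icc]
    constructor
    · rintro ⟨ha, hb⟩
      have ht0 : 0 ≤ t := by
        by_contra hc
        have : t * 2 ^ j < 0 := mul_neg_of_neg_of_pos (not_le.mp hc) hp
        have : (0 : ℝ) ≤ k := Nat.cast_nonneg k
        linarith
      have : k ≤ ⌊t * 2 ^ j⌋₊ := Nat.le_floor ha
      exact ⟨⟨ht0, hb⟩, by omega⟩
    · rintro ⟨⟨h0, h1⟩, he⟩
      have : k ≤ ⌊t * 2 ^ j⌋₊ := by omega
      exact ⟨(Nat.le_floor_iff (by positivity)).mp this, h1⟩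

/-- Labels start at 1, so the parent of label l is ⌈l/2⌉. The truncation at 2^j, which puts t = 1 in
the last closed interval, is compatible with this halving. -/
lemma dyadicIndex_eq_half (j : ℕ) (t : ℝ) :
    dyadicIndex j t = (dyadicIndex (j + 1) t + 1) / 2 := by
  have h : ⌊t * 2 ^ j⌋₊ = ⌊t * 2 ^ (j + 1)⌋₊ / 2 := by
    rw [← Nat.floor_div_ofNat, pow_succ]
    congr 1
    simp only [OfNat.ofNat]
    ring
  unfold dyadicIndex
  rw [h, pow_succ]
  omega

lemma dyadicIndex_eq_of_le {i j : ℕ} (hij : i ≤ j) {t u : ℝ}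
    (h : dyadicIndex j t = dyadicIndex j u) : dyadicIndex i t = dyadicIndex i u := by
  induction j, hij using Nat.le_induction with
  | base => exact h
  | succ j _ ih => exact ih (by rw [dyadicIndex_eq_half j t, dyadicIndex_eq_half j u, h])

lemma exists_dyadicIndex_eq {j l : ℕ} (h1 : 1 ≤ l) (h2 : l ≤ 2 ^ j) :
    ∃ t ∈ Set.Icc (0 : ℝ) 1, dyadicIndex j t = l := by
  have hp : (0 : ℝ) < 2 ^ j := by positivity
  have hl : (l : ℝ) ≤ 2 ^ j := by exact_mod_cast h2
  have hl1 : (1 : ℝ) ≤ l := by exact_mod_cast h1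
  refine ⟨((l : ℝ) - 1) / 2 ^ j, ?_⟩
  rw [← mem_dyadicInterval_iff h1 h2]
  unfold dyadicInterval
  split_ifs
  · exact ⟨le_rfl, by gcongr; linarith⟩
  · exact ⟨le_rfl, by rw [div_le_one hp]; linarith⟩

variable {d : ℕ}

lemma mem_unitSquare_iff {p : Pair d} :
    p ∈ unitSquare d ↔
      (∀ i, p.1 i ∈ Set.Icc (0 : ℝ) 1) ∧ ∀ i, p.2 i ∈ Set.Icc (0 : ℝ) 1 := by
  simp only [unitSquare, unitCube, Set.mem_prod, Set.mem_Icc, Pi.le_def, Pi.zero_apply,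
    Pi.one_apply, forall_and]

/-- The label of the dyadic cube of level `j` that contains `p`. -/
def dyadicCode (j : ℕ) (p : Pair d) : Fin d ⊕ Fin d → ℕ :=
  Sum.elim (fun i => dyadicIndex j (p.1 i)) (fun i => dyadicIndex j (p.2 i))

lemma dyadicCode_eq_iff {j : ℕ} {p : Pair d} {l : Fin d ⊕ Fin d → ℕ} :
    dyadicCode j p = l ↔ (∀ i, dyadicIndex j (p.1 i) = l (Sum.inl i)) ∧
      ∀ i, dyadicIndex j (p.2 i) = l (Sum.inr i) := by
  rw [funext_iff, Sum.forall]; rfl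

/-- The dyadic cube of level `j` that contains `p`. -/
def dyadicCell (j : ℕ) (p : Pair d) : Set (Pair d) :=
  {q | q ∈ unitSquare d ∧ dyadicCode j q = dyadicCode j p}

lemma dyadicCube_eq {j : ℕ} {l : Fin d ⊕ Fin d → ℕ} (hl : ∀ i, l i ∈ Finset.Icc 1 (2 ^ j)) :
    dyadicCube j l = {q : Pair d | q ∈ unitSquare d ∧ dyadicCode j q = l} := by
  ext q
  simp only [Finset.mem_Icc] at hl
  simp only [dyadicCube, Set.mem_ofPred_eq, mem_unitSquare_iff, dyadicCode_eq_iff,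
    fun i => mem_dyadicInterval_iff (t := q.1 i) (hl (Sum.inl i)).1 (hl (Sum.inl i)).2,
    fun i => mem_dyadicInterval_iff (t := q.2 i) (hl (Sum.inr i)).1 (hl (Sum.inr i)).2,
    forall_and]
  tauto

lemma dyadicCode_mem (j : ℕ) (p : Pair d) (i : Fin d ⊕ Fin d) :
    dyadicCode j p i ∈ Finset.Icc 1 (2 ^ j) := by
  rw [Finset.mem_Icc]
  cases i <;> exact ⟨one_le_dyadicIndex _ _, dyadicIndex_le _ _⟩

lemma exists_dyadicCode_eq {j : ℕ} {l : Fin d ⊕ Fin d → ℕ}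
    (hl : ∀ i, l i ∈ Finset.Icc 1 (2 ^ j)) : ∃ p ∈ unitSquare d, dyadicCode j p = l := by
  simp only [Finset.mem_Icc] at hl
  choose t ht hti using fun i => exists_dyadicIndex_eq (hl i).1 (hl i).2
  refine ⟨(fun i => t (Sum.inl i), fun i => t (Sum.inr i)), ?_, ?_⟩
  · rw [mem_unitSquare_iff]; exact ⟨fun i => ht _, fun i => ht _⟩
  · rw [dyadicCode_eq_iff]; exact ⟨fun i => hti _, fun i => hti _⟩

lemma mem_dyadicCubes_iff {j : ℕ} {K : Set (Pair d)} :
    K ∈ dyadicCubes d j ↔ ∃ p ∈ unitSquare d, K = dyadicCell j p := by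
  simp only [dyadicCubes, Finset.mem_image, Fintype.mem_piFinset]
  constructor
  · rintro ⟨l, hl, rfl⟩
    obtain ⟨p, hp, rfl⟩ := exists_dyadicCode_eq hl
    exact ⟨p, hp, dyadicCube_eq hl⟩
  · rintro ⟨p, -, rfl⟩
    exact ⟨dyadicCode j p, dyadicCode_mem j p, dyadicCube_eq (dyadicCode_mem j p)⟩

lemma mem_dyadicCell_self {j : ℕ} {p : Pair d} (hp : p ∈ unitSquare d) : p ∈ dyadicCell j p :=
  ⟨hp, rfl⟩

lemma dyadicCell_mem_dyadicCubes {j : ℕ} {p : Pair d} (hp : p ∈ unitSquare d) :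
    dyadicCell j p ∈ dyadicCubes d j := mem_dyadicCubes_iff.mpr ⟨p, hp, rfl⟩

lemma eq_dyadicCell {j : ℕ} {K : Set (Pair d)} (hK : K ∈ dyadicCubes d j) {p : Pair d}
    (hp : p ∈ K) : K = dyadicCell j p := by
  obtain ⟨q, hq, rfl⟩ := mem_dyadicCubes_iff.mp hK
  ext r
  simp only [dyadicCell, Set.mem_ofPred_eq, hp.2]

lemma subset_unitSquare {j : ℕ} {K : Set (Pair d)} (hK : K ∈ dyadicCubes d j) :
    K ⊆ unitSquare d := by
  obtain ⟨q, hq, rfl⟩ := mem_dyadicCubes_iff.mp hK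
  exact fun p hp => hp.1

lemma nonempty_of_mem_dyadicCubes {j : ℕ} {K : Set (Pair d)} (hK : K ∈ dyadicCubes d j) :
    K.Nonempty := by
  obtain ⟨q, hq, rfl⟩ := mem_dyadicCubes_iff.mp hK
  exact ⟨q, mem_dyadicCell_self hq⟩

lemma dyadicCell_subset {i j : ℕ} (hij : i ≤ j) (p : Pair d) :
    dyadicCell j p ⊆ dyadicCell i p := by
  rintro q ⟨hq, h⟩
  refine ⟨hq, ?_⟩
  rw [dyadicCode_eq_iff] at h ⊢
  exact ⟨fun k => dyadicIndex_eq_of_le hij (h.1 k), fun k => dyadicIndex_eq_of_le hij (h.2 k)⟩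

/-- Two dyadic cubes that meet are nested. -/
lemma subset_of_mem_of_le {i j : ℕ} (hij : i ≤ j) {K K' : Set (Pair d)}
    (hK : K ∈ dyadicCubes d i) (hK' : K' ∈ dyadicCubes d j) {p : Pair d} (hp : p ∈ K)
    (hp' : p ∈ K') : K' ⊆ K := by
  rw [eq_dyadicCell hK hp, eq_dyadicCell hK' hp']
  exact dyadicCell_subset hij p

lemma zero_mem_unitSquare : (0 : Pair d) ∈ unitSquare d := by
  rw [mem_unitSquare_iff]; simp

lemma unitSquare_mem_dyadicCubes : unitSquare d ∈ dyadicCubes d 0 := by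
  refine mem_dyadicCubes_iff.mpr ⟨0, zero_mem_unitSquare, ?_⟩
  ext q
  simp only [dyadicCell, Set.mem_ofPred_eq, iff_self_and]
  intro _
  rw [dyadicCode_eq_iff]
  simp [dyadicCode, dyadicIndex]

/-- One coordinate of p is moved to the sibling half of its level-j interval; such a coordinate
exists because d > 0. This is what makes levels strictly separate cubes. -/
lemma exists_mem_dyadicCell_notMem_succ (hd : 0 < d) (j : ℕ) {p : Pair d}
    (hp : p ∈ unitSquare d) : ∃ q ∈ dyadicCell j p, q ∉ dyadicCell (j + 1) p := by
  classical
  let i₀ : Fin d := ⟨0, hd⟩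
  set a := dyadicIndex (j + 1) (p.1 i₀) with ha
  have ha1 : 1 ≤ a := one_le_dyadicIndex _ _
  have ha2 : a ≤ 2 ^ (j + 1) := dyadicIndex_le _ _
  obtain ⟨b, hb1, hb2, hab, hne⟩ :
      ∃ b, 1 ≤ b ∧ b ≤ 2 ^ (j + 1) ∧ (b + 1) / 2 = (a + 1) / 2 ∧ b ≠ a := by
    rw [pow_succ] at *
    rcases Nat.even_or_odd' a with ⟨c, hc | hc⟩
    · exact ⟨a - 1, by omega, by omega, by omega, by omega⟩
    · exact ⟨a + 1, by omega, by omega, by omega, by omega⟩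
  obtain ⟨t, ht, htb⟩ := exists_dyadicIndex_eq hb1 hb2
  refine ⟨(Function.update p.1 i₀ t, p.2), ⟨?_, ?_⟩, ?_⟩
  · rw [mem_unitSquare_iff] at hp ⊢
    refine ⟨fun i => ?_, hp.2⟩
    by_cases hi : i = i₀
    · subst hi; simpa using ht
    · simpa [hi] using hp.1 i
  · rw [dyadicCode_eq_iff]
    refine ⟨fun i => ?_, fun i => rfl⟩
    by_cases hi : i = i₀
    · subst hi
      simp only [Function.update_self, dyadicCode, Sum.elim_inl]
      rw [dyadicIndex_eq_half j t, htb, hab, dyadicIndex_eq_half j (p.1 i₀)]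
    · simp [hi, dyadicCode]
  · rintro ⟨-, h⟩
    rw [dyadicCode_eq_iff] at h
    have := h.1 i₀
    simp only [Function.update_self, dyadicCode, Sum.elim_inl] at this
    exact hne (by rw [← htb, this])

lemma measurableSet_unitCube : MeasurableSet (unitCube d) := measurableSet_Icc

lemma measurableSet_unitSquare : MeasurableSet (unitSquare d) :=
  measurableSet_unitCube.prod measurableSet_unitCube

lemma measurableSet_dyadicInterval (j l : ℕ) : MeasurableSet (dyadicInterval j l) := by
  unfold dyadicInterval
  split_ifs
  · exact measurableSet_Ico
  · exact measurableSet_Icc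

/-- A dyadic cube is the product of two measurable sets. -/
lemma exists_prod_of_mem_dyadicCubes {j : ℕ} {K : Set (Pair d)} (hK : K ∈ dyadicCubes d j) :
    ∃ K₁ K₂ : Set (Fin d → ℝ), MeasurableSet K₁ ∧ MeasurableSet K₂ ∧ K = K₁ ×ˢ K₂ := by
  simp only [dyadicCubes, Finset.mem_image] at hK
  obtain ⟨l, -, rfl⟩ := hK
  refine ⟨Set.univ.pi fun i => dyadicInterval j (l (Sum.inl i)),
    Set.univ.pi fun i => dyadicInterval j (l (Sum.inr i)),
    MeasurableSet.univ_pi fun i => measurableSet_dyadicInterval _ _,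
    MeasurableSet.univ_pi fun i => measurableSet_dyadicInterval _ _, ?_⟩
  ext p
  simp [dyadicCube]

lemma measurableSet_of_mem_dyadicCubes {j : ℕ} {K : Set (Pair d)} (hK : K ∈ dyadicCubes d j) :
    MeasurableSet K := by
  obtain ⟨K₁, K₂, h₁, h₂, rfl⟩ := exists_prod_of_mem_dyadicCubes hK
  exact h₁.prod h₂

/-! ### Dyadic partitions -/

/-- A finite partition of `[0,1]^{2d}` into dyadic cubes. -/
structure IsDyadicPartition (m : Finset (Set (Pair d))) : Prop where
  exists_level : ∀ K ∈ m, ∃ j, K ∈ dyadicCubes d j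
  existsUnique_mem : ∀ p ∈ unitSquare d, ∃! K, K ∈ m ∧ p ∈ K

namespace IsDyadicPartition

variable {m m' : Finset (Set (Pair d))}

lemma eq_of_mem (hm : IsDyadicPartition m) {K K' : Set (Pair d)} (hK : K ∈ m) (hK' : K' ∈ m)
    {p : Pair d} (hp : p ∈ K) (hp' : p ∈ K') : K = K' := by
  obtain ⟨j, hj⟩ := hm.exists_level K hK
  exact (hm.existsUnique_mem p (subset_unitSquare hj hp)).unique ⟨hK, hp⟩ ⟨hK', hp'⟩

lemma subset (hm : IsDyadicPartition m) {K : Set (Pair d)} (hK : K ∈ m) : K ⊆ unitSquare d :=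
  let ⟨_, hj⟩ := hm.exists_level K hK
  subset_unitSquare hj

lemma nonempty (hm : IsDyadicPartition m) {K : Set (Pair d)} (hK : K ∈ m) : K.Nonempty :=
  let ⟨_, hj⟩ := hm.exists_level K hK
  nonempty_of_mem_dyadicCubes hj

lemma measurableSet (hm : IsDyadicPartition m) {K : Set (Pair d)} (hK : K ∈ m) :
    MeasurableSet K :=
  let ⟨_, hj⟩ := hm.exists_level K hK
  measurableSet_of_mem_dyadicCubes hj

lemma singleton : IsDyadicPartition ({unitSquare d} : Finset (Set (Pair d))) where
  exists_level K hK := by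
    rw [Finset.mem_singleton] at hK
    subst hK
    exact ⟨0, unitSquare_mem_dyadicCubes⟩
  existsUnique_mem p hp := ⟨unitSquare d, by simpa using hp, fun K hK => by simpa using hK.1⟩

open Classical in
lemma step (hm : IsDyadicPartition m) (h : IsStep m m') : IsDyadicPartition m' := by
  obtain ⟨D, hD, j, hj, rfl⟩ := h
  constructor
  · intro K hK
    simp only [Finset.mem_union, Finset.mem_sdiff, Finset.mem_biUnion, Finset.mem_filter] at hK
    rcases hK with hK | ⟨K', -, hK, -⟩
    · exact hm.exists_level K hK.1
    · exact ⟨_, hK⟩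
  · intro p hp
    obtain ⟨K, ⟨hKm, hpK⟩, huniq⟩ := hm.existsUnique_mem p hp
    by_cases hKD : K ∈ D
    · refine ⟨dyadicCell (j K + 1) p, ⟨?_, mem_dyadicCell_self hp⟩, ?_⟩
      · simp only [Finset.mem_union, Finset.mem_biUnion, Finset.mem_filter]
        refine Or.inr ⟨K, hKD, dyadicCell_mem_dyadicCubes hp, ?_⟩
        conv_rhs => rw [eq_dyadicCell (hj K hKD) hpK]
        exact dyadicCell_subset (Nat.le_succ _) p
      · rintro K' ⟨hK', hpK'⟩
        simp only [Finset.mem_union, Finset.mem_sdiff, Finset.mem_biUnion,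
          Finset.mem_filter] at hK'
        rcases hK' with hK' | ⟨K'', hK'', hK', hs⟩
        · exact absurd (huniq K' ⟨hK'.1, hpK'⟩ ▸ hKD) hK'.2
        · have : K'' = K := huniq K'' ⟨hD hK'', hs hpK'⟩
          subst this
          exact eq_dyadicCell hK' hpK'
    · refine ⟨K, ⟨?_, hpK⟩, ?_⟩
      · simp only [Finset.mem_union, Finset.mem_sdiff]
        exact Or.inl ⟨hKm, hKD⟩
      · rintro K' ⟨hK', hpK'⟩
        simp only [Finset.mem_union, Finset.mem_sdiff, Finset.mem_biUnion,
          Finset.mem_filter] at hK'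
        rcases hK' with hK' | ⟨K'', hK'', hK', hs⟩
        · exact huniq K' ⟨hK'.1, hpK'⟩
        · exact absurd (huniq K'' ⟨hD hK'', hs hpK'⟩ ▸ hK'') hKD

lemma of_mem_partitionsAfter {k : ℕ} (h : m ∈ partitionsAfter d k) : IsDyadicPartition m := by
  induction k generalizing m with
  | zero =>
    simp only [partitionsAfter, Set.mem_singleton_iff] at h
    subst h
    exact singleton
  | succ k ih =>
    obtain ⟨m₀, hm₀, hs⟩ := h
    exact (ih hm₀).step hs

lemma of_mem_partitions {ℓ : ℕ∞} (h : m ∈ partitions d ℓ) : IsDyadicPartition m := by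
  obtain ⟨k, -, hk⟩ := h
  exact of_mem_partitionsAfter hk

/-- The intersection of two cubes that meet is the smaller one. -/
lemma exists_level_inter (hm : IsDyadicPartition m) (hm' : IsDyadicPartition m')
    {K K' : Set (Pair d)} (hK : K ∈ m) (hK' : K' ∈ m') (h : (K ∩ K').Nonempty) :
    K ∩ K' = K ∨ K ∩ K' = K' := by
  obtain ⟨i, hi⟩ := hm.exists_level K hK
  obtain ⟨j, hj⟩ := hm'.exists_level K' hK'
  obtain ⟨p, hp, hp'⟩ := h
  rcases le_total i j with hij | hij
  · exact Or.inr (Set.inter_eq_right.mpr (subset_of_mem_of_le hij hi hj hp hp'))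
  · exact Or.inl (Set.inter_eq_left.mpr (subset_of_mem_of_le hij hj hi hp' hp))

open Classical in
lemma card_join (hm : IsDyadicPartition m) (K : Set (Pair d)) :
    (join m K).card = (m.filter fun K' => (K ∩ K').Nonempty).card := by
  unfold join
  simp only [Set.inter_comm _ K]
  apply Finset.card_image_of_injOn
  intro K₁ h₁ K₂ h₂ h
  simp only [Finset.coe_filter, Set.mem_ofPred_eq] at h₁ h₂
  obtain ⟨p, hp⟩ := h₁.2
  have h' : K ∩ K₁ = K ∩ K₂ := h
  exact hm.eq_of_mem h₁.1 h₂.1 hp.2 (h' ▸ hp).2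

-- Dyadic cubes that meet are nested, so each cell K ∩ K' of the common refinement is K or K'. A
-- nonempty intersection determines the pair, which makes this an injection into the union. Hence
-- joins cost at most |m| + |m'| in total.
open Classical in
lemma sum_card_join_le (hm : IsDyadicPartition m) (hm' : IsDyadicPartition m') :
    ∑ K ∈ m, (join m' K).card ≤ (m ∪ m').card := by
  simp only [hm'.card_join]
  rw [← Finset.card_sigma]
  refine Finset.card_le_card_of_injOn (fun q => q.1 ∩ q.2) ?_ ?_
  · rintro ⟨K, K'⟩ h
    simp only [Finset.coe_sigma, Finset.coe_filter, Set.mem_sigma_iff, Finset.mem_coe,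
      Set.mem_ofPred_eq] at h
    simp only [Finset.coe_union, Set.mem_union, Finset.mem_coe]
    rcases hm.exists_level_inter hm' h.1 h.2.1 h.2.2 with h' | h' <;> rw [h']
    · exact Or.inl h.1
    · exact Or.inr h.2.1
  · rintro ⟨K₁, K₁'⟩ h₁ ⟨K₂, K₂'⟩ h₂ h
    simp only [Finset.coe_sigma, Finset.coe_filter, Set.mem_sigma_iff, Finset.mem_coe,
      Set.mem_ofPred_eq] at h₁ h₂ h
    obtain ⟨p, hp⟩ := h₁.2.2
    have hp' : p ∈ K₂ ∩ K₂' := h ▸ hp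
    obtain rfl := hm.eq_of_mem h₁.1 h₂.1 hp.1 hp'.1
    obtain rfl := hm'.eq_of_mem h₁.2.1 h₂.2.1 hp.2 hp'.2
    rfl

/-- Deep cubes are expensive: a partition that contains a cube of level `b` inside a cube `K` of
level `a` has at least `b - a` pieces in `K`. -/
lemma le_add_card_join (hd : 0 < d) (hm : IsDyadicPartition m) {a b : ℕ} {K K' : Set (Pair d)}
    (hK : K ∈ dyadicCubes d a) (hK'm : K' ∈ m) (hK' : K' ∈ dyadicCubes d b)
    (h : (K ∩ K').Nonempty) : b ≤ a + (join m K).card := by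
  classical
  obtain ⟨p, hp, hp'⟩ := h
  have hpA := subset_unitSquare hK hp
  have hcell : K' = dyadicCell b p := eq_dyadicCell hK' hp'
  -- For i < b, the element E i of m that contains q i lies in the shell between the level-i and
  -- level-(i+1) cells around p: it cannot be larger without containing p, hence being K'. The
  -- shells are disjoint, so the E i are distinct, and those with a ≤ i < b lie in K.
  choose q hq hq' using fun i => exists_mem_dyadicCell_notMem_succ hd i hpA
  choose E hE huniq using fun i => hm.existsUnique_mem (q i) (hq i).1
  have hEK' : ∀ i, i < b → p ∉ E i := by
    intro i hi hpE
    have hE' : E i = K' := hm.eq_of_mem (hE i).1 hK'm hpE hp'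
    have hqK' : q i ∈ dyadicCell b p := by rw [← hcell, ← hE']; exact (hE i).2
    exact hq' i (dyadicCell_subset hi p hqK')
  have hsub : ∀ i, i < b → E i ⊆ dyadicCell i p := by
    intro i hi
    obtain ⟨e, he⟩ := hm.exists_level (E i) (hE i).1
    rcases le_total i e with hie | hie
    · exact subset_of_mem_of_le hie (dyadicCell_mem_dyadicCubes hpA) he (hq i) (hE i).2
    · exact absurd (subset_of_mem_of_le hie he (dyadicCell_mem_dyadicCubes hpA) (hE i).2 (hq i)
        (mem_dyadicCell_self hpA)) (hEK' i hi)
  have hdisj : ∀ i, i < b → ∀ r ∈ E i, r ∉ dyadicCell (i + 1) p := by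
    intro i hi r hr hr'
    obtain ⟨e, he⟩ := hm.exists_level (E i) (hE i).1
    have hc := dyadicCell_mem_dyadicCubes (j := i + 1) hpA
    rcases le_total (i + 1) e with hie | hie
    · exact hq' i (subset_of_mem_of_le hie hc he hr' hr (hE i).2)
    · exact hEK' i hi (subset_of_mem_of_le hie he hc hr hr' (mem_dyadicCell_self hpA))
  have hlt : ∀ i j, i < j → j < b → E i ≠ E j := by
    intro i j hij hjb hEq
    have h1 := hsub j hjb (hE j).2
    exact hdisj i (hij.trans hjb) (q j) (hEq ▸ (hE j).2) (dyadicCell_subset hij p h1)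
  rw [hm.card_join]
  suffices hcard : (Finset.Ico a b).card ≤ (m.filter fun K' => (K ∩ K').Nonempty).card by
    rw [Nat.card_Ico] at hcard
    omega
  refine Finset.card_le_card_of_injOn E ?_ ?_
  · intro i hi
    simp only [Finset.coe_Ico, Set.mem_Ico] at hi
    simp only [Finset.coe_filter, Set.mem_ofPred_eq]
    refine ⟨(hE i).1, q i, ?_, (hE i).2⟩
    rw [eq_dyadicCell hK hp]
    exact dyadicCell_subset hi.1 p (hq i)
  · intro i hi j hj hij
    simp only [Finset.coe_Ico, Set.mem_Ico] at hi hj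
    rcases lt_trichotomy i j with h | h | h
    · exact absurd hij (hlt i j h hj.2)
    · exact h
    · exact absurd hij.symm (hlt j i h hi.2)

lemma level_le_card (hd : 0 < d) (hm : IsDyadicPartition m) {b : ℕ} {K : Set (Pair d)}
    (hKm : K ∈ m) (hK : K ∈ dyadicCubes d b) : b ≤ m.card := by
  classical
  have h := hm.le_add_card_join hd unitSquare_mem_dyadicCubes hKm hK
    ((hm.nonempty hKm).mono (Set.subset_inter (hm.subset hKm) subset_rfl))
  rw [hm.card_join] at h
  exact (h.trans (by simpa using Finset.card_filter_le _ _))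

lemma card_pos (hm : IsDyadicPartition m) : 0 < m.card := by
  obtain ⟨K, ⟨hK, -⟩, -⟩ := hm.existsUnique_mem 0 zero_mem_unitSquare
  exact Finset.card_pos.mpr ⟨K, hK⟩

end IsDyadicPartition

lemma singleton_mem_partitions (d : ℕ) (ℓ : ℕ∞) :
    ({unitSquare d} : Finset (Set (Pair d))) ∈ partitions d ℓ :=
  ⟨0, by simp, by simp [partitionsAfter]⟩

/-- Countability lets the measurability of the loss at the selected partition be checked one
partition at a time. -/
lemma countable_partitions (d : ℕ) (ℓ : ℕ∞) : (partitions d ℓ).Countable := by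
  have h : (⋃ j, (dyadicCubes d j : Set (Set (Pair d)))).Countable :=
    Set.countable_iUnion fun j => (dyadicCubes d j).countable_toSet
  refine (Set.countable_ofPred_finite_subset h).preimage_of_injOn
    (f := fun m : Finset (Set (Pair d)) => (m : Set (Set (Pair d))))
    (Finset.coe_injective.injOn) |>.mono ?_
  intro m hm
  refine ⟨m.finite_toSet, fun K hK => ?_⟩
  obtain ⟨j, hj⟩ := (IsDyadicPartition.of_mem_partitions hm).exists_level K hK
  exact Set.mem_iUnion.mpr ⟨j, hj⟩

/-! ### Inequalities on a single cell -/

/-- The contribution `∫ (√s - √a)²` of a cell to the loss, in terms of the integrals `D`, `R`, `S`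
of `1`, `√s` and `s` on this cell. -/
def cellLoss (D R S a : ℝ) : ℝ := S - 2 * Real.sqrt a * R + a * D

/-- The contribution of a cell with `N` observed transitions to the test functional, up to the
factor `1 / n`. -/
def cellTest (D N a b : ℝ) : ℝ :=
  1 / (2 * Real.sqrt 2) * (D * (Real.sqrt (a + b) * (Real.sqrt b - Real.sqrt a)))
    + 1 / Real.sqrt 2 * (N * ((Real.sqrt b - Real.sqrt a) / Real.sqrt (a + b)))
    + 1 / 2 * (D * (a - b))

/-- `D`, `R`, `S` behave as the integrals of `1`, `σ`, `σ²` for some function `σ ≥ 0`. -/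
def IsMomentTriple (D R S : ℝ) : Prop :=
  ∀ A B C : ℝ, (∀ σ, 0 ≤ σ → 0 ≤ A * σ ^ 2 + B * σ + C) → 0 ≤ A * S + B * R + C * D

/-- The number `N` of observed transitions is close to its compensator `S`. -/
def IsConcentrated (n : ℕ) (N S : ℝ) : Prop :=
  ∀ k : ℕ, 1 ≤ k → k ≤ n →
    N - S ≤ S / k + k * (4 * Real.log n) ∧ S - N ≤ S / k + k * (4 * Real.log n)

namespace IsMomentTriple

variable {D R S : ℝ}

lemma nonneg_left (h : IsMomentTriple D R S) : 0 ≤ D := by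
  simpa using h 0 0 1 (by simp)

lemma nonneg_middle (h : IsMomentTriple D R S) : 0 ≤ R := by
  simpa using h 0 1 0 (by simp)

lemma nonneg_right (h : IsMomentTriple D R S) : 0 ≤ S := by
  simpa using h 1 0 0 (fun σ _ => by positivity)

lemma quadratic_nonneg (h : IsMomentTriple D R S) (t : ℝ) : 0 ≤ S - 2 * t * R + t ^ 2 * D := by
  have := h 1 (-2 * t) (t ^ 2) (fun σ _ => by nlinarith [sq_nonneg (σ - t)])
  linarith

lemma cellLoss_nonneg (h : IsMomentTriple D R S) {a : ℝ} (ha : 0 ≤ a) :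
    0 ≤ cellLoss D R S a := by
  have := h.quadratic_nonneg (Real.sqrt a)
  rwa [Real.sq_sqrt ha] at this

lemma middle_eq_zero (h : IsMomentTriple D R S) (hD : D = 0) : R = 0 := by
  have h0 := h.nonneg_middle
  by_contra hR
  have hpos : 0 < R := lt_of_le_of_ne h0 (Ne.symm hR)
  -- With D = 0 the quadratic is affine in t; at this t it equals S - 2(S + 1) < 0.
  have := h.quadratic_nonneg ((S + 1) / R)
  rw [hD] at this
  have h1 : 2 * ((S + 1) / R) * R = 2 * (S + 1) := by field_simp
  rw [h1] at this
  linarith [h.nonneg_right]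

/-- The minimum of the loss on a cell. -/
lemma cellLoss_min (h : IsMomentTriple D R S) {a : ℝ} (ha : 0 ≤ a) :
    cellLoss D R S ((R / D) ^ 2) ≤ cellLoss D R S a := by
  have hR := h.nonneg_middle
  have hD := h.nonneg_left
  unfold cellLoss
  rw [Real.sqrt_sq (by positivity)]
  rcases hD.eq_or_lt with hD0 | hD0
  · rw [h.middle_eq_zero hD0.symm, ← hD0]; simp
  · have h1 : S - 2 * (R / D) * R + (R / D) ^ 2 * D = S - R ^ 2 / D := by field_simp; ring
    have h2 : S - 2 * Real.sqrt a * R + a * D - (S - R ^ 2 / D)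
        = D * (Real.sqrt a - R / D) ^ 2 := by
      nth_rewrite 2 [← Real.sq_sqrt ha]
      field_simp
      ring
    have h3 : 0 ≤ D * (Real.sqrt a - R / D) ^ 2 := by positivity
    linarith

end IsMomentTriple

namespace IsConcentrated

variable {n : ℕ} {N S : ℝ}

/-- The deviation bound is used at scale k = ⌈200/φ⌉: then φ/k ≤ φ²/200 and φk ≤ 201, whence 804 = 4
· 201. The weight φ² on V is what lets a small contrast between two candidates pay for its own
noise. -/
lemma mul_sub_le_of_pos {φ U V : ℝ} (hφ0 : 0 < φ) (hφ1 : φ ≤ 1) (hn : 1 ≤ Real.log n)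
    (hU : U ≤ n) (h : ∀ k : ℕ, 1 ≤ k → k ≤ n → U ≤ V / k + k * (4 * Real.log n)) (hV : 0 ≤ V) :
    φ * U ≤ 1 / 200 * φ ^ 2 * V + 804 * Real.log n := by
  set k := ⌈200 / φ⌉₊ with hk
  have hk1 : 200 / φ ≤ k := Nat.le_ceil _
  have hk2 : (k : ℝ) < 200 / φ + 1 := Nat.ceil_lt_add_one (by positivity)
  have hkpos : 0 < k := Nat.ceil_pos.mpr (by positivity)
  have hkR : (0 : ℝ) < k := by exact_mod_cast hkpos
  have hφk : 200 ≤ φ * k := by rw [div_le_iff₀ hφ0] at hk1; linarith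
  have hφk2 : φ * k ≤ 201 := by
    have : φ * k ≤ φ * (200 / φ + 1) := by gcongr
    have h2 : φ * (200 / φ + 1) = 200 + φ := by field_simp
    linarith
  by_cases hkn : k ≤ n
  · have h1 := mul_le_mul_of_nonneg_left (h k hkpos hkn) hφ0.le
    have h2 : φ * (V / k) ≤ 1 / 200 * φ ^ 2 * V := by
      have : φ / k ≤ 1 / 200 * φ ^ 2 := by
        rw [div_le_iff₀ hkR]
        nlinarith
      calc φ * (V / k) = φ / k * V := by ring
        _ ≤ _ := by gcongr
    have h3 : φ * (k * (4 * Real.log n)) ≤ 804 * Real.log n := by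
      calc φ * (k * (4 * Real.log n)) = φ * k * (4 * Real.log n) := by ring
        _ ≤ 201 * (4 * Real.log n) := by gcongr
        _ = _ := by ring
    linarith
  -- At scales beyond n no deviation bound is available, but U ≤ n ≤ k already gives φU ≤ 201.
  · have hnk : (n : ℝ) ≤ k := by exact_mod_cast (not_le.mp hkn).le
    have h1 : φ * U ≤ 201 := (mul_le_mul_of_nonneg_left (hU.trans hnk) hφ0.le).trans hφk2
    have h2 : 0 ≤ 1 / 200 * φ ^ 2 * V := by positivity
    linarith

lemma mul_sub_le (h : IsConcentrated n N S) (hn : 1 ≤ Real.log n) (hN0 : 0 ≤ N) (hN : N ≤ n)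
    (hS0 : 0 ≤ S) (hS : S ≤ n) {φ : ℝ} (hφ : |φ| ≤ 1) :
    φ * (N - S) ≤ 1 / 200 * φ ^ 2 * S + 804 * Real.log n := by
  rcases lt_trichotomy φ 0 with h0 | h0 | h0
  · have := mul_sub_le_of_pos (φ := -φ) (U := S - N) (V := S) (by linarith)
      (by linarith [(abs_le.mp hφ).1]) hn (by linarith) (fun k h1 h2 => (h k h1 h2).2) hS0
    calc φ * (N - S) = -φ * (S - N) := by ring
      _ ≤ _ := this
      _ = _ := by ring
  · subst h0; simp; linarith
  · exact mul_sub_le_of_pos h0 (abs_le.mp hφ).2 hn (by linarith)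
      (fun k h1 h2 => (h k h1 h2).1) hS0

/-- Take φ = (√N - √S)/(√N + √S): then φ(N - S) is the square to be bounded, and φ²S is at most that
square. The fraction 1/200 is moved to the left, and 804 · 200/199 ≤ 809. -/
lemma sq_sqrt_sub_sqrt_le (h : IsConcentrated n N S) (hn : 1 ≤ Real.log n) (hN0 : 0 ≤ N)
    (hN : N ≤ n) (hS0 : 0 ≤ S) (hS : S ≤ n) :
    (Real.sqrt S - Real.sqrt N) ^ 2 ≤ 809 * Real.log n := by
  set x := Real.sqrt N with hx
  set y := Real.sqrt S with hy
  have hx0 : 0 ≤ x := Real.sqrt_nonneg _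
  have hy0 : 0 ≤ y := Real.sqrt_nonneg _
  have hxN : N = x ^ 2 := (Real.sq_sqrt hN0).symm
  have hyS : S = y ^ 2 := (Real.sq_sqrt hS0).symm
  rcases (add_nonneg hx0 hy0).eq_or_lt with h0 | h0
  · have hx' : x = 0 := by linarith
    have hy' : y = 0 := by linarith
    rw [hx', hy']
    simp
    linarith
  · have habs : |(x - y) / (x + y)| ≤ 1 := by
      rw [abs_le, le_div_iff₀ h0, div_le_iff₀ h0]
      constructor <;> linarith
    have h1 := h.mul_sub_le hn hN0 hN hS0 hS habs
    have h2 : (x - y) / (x + y) * (N - S) = (y - x) ^ 2 := by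
      rw [hxN, hyS]; field_simp; ring
    have h3 : ((x - y) / (x + y)) ^ 2 * S ≤ (y - x) ^ 2 := by
      rw [hyS, div_pow, div_mul_eq_mul_div, div_le_iff₀ (by positivity)]
      have : y ^ 2 ≤ (x + y) ^ 2 := by nlinarith
      nlinarith [sq_nonneg (x - y)]
    rw [h2] at h1
    nlinarith

end IsConcentrated

/-- Here c stands for √2 and w for √(p² + q²), so wc/2 is the square root of the average density.
The left side equals (c/2) φ (wc/2 - σ)² + (σ-p)²/2 - (σ-q)²/2. The squared Hellinger distance to
the average density is at most the mean of the distances to the two candidates, and φ ≤ 1. -/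
lemma pointwise_mean_le {p q σ c w φ : ℝ} (hcc : c ^ 2 = 2) (hc0 : 0 ≤ c)
    (hw2 : w ^ 2 = p ^ 2 + q ^ 2) (hφw : φ * w = q - p) (hφ1 : φ ≤ 1) (hge : p + q ≤ w * c)
    (hσ : 0 ≤ σ) :
    c / 4 * (w * (q - p)) + c / 2 * (σ ^ 2 * φ) + 1 / 2 * (p ^ 2 - q ^ 2)
      ≤ (1 / 2 + c / 4) * (σ - p) ^ 2 - (1 / 2 - c / 4) * (σ - q) ^ 2 := by
  have hr : (w * c / 2 - σ) ^ 2 ≤ ((σ - p) ^ 2 + (σ - q) ^ 2) / 2 := by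
    have h1 : (w * c / 2 - σ) ^ 2 = (p ^ 2 + q ^ 2) / 2 - w * c * σ + σ ^ 2 := by
      rw [← hw2]; linear_combination (w ^ 2 / 4) * hcc
    have h2 := mul_le_mul_of_nonneg_right hge hσ
    rw [h1]
    linarith
  have h1 : c / 4 * (w * (q - p)) + c / 2 * (σ ^ 2 * φ) + 1 / 2 * (p ^ 2 - q ^ 2)
      = c / 2 * (φ * (w * c / 2 - σ) ^ 2) + 1 / 2 * (σ - p) ^ 2 - 1 / 2 * (σ - q) ^ 2 := by
    have h2 : q = φ * w + p := by linarith
    rw [h2]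
    linear_combination (c * φ * (-(w ^ 2) / 8) + φ * w * σ / 2) * hcc
  have h3 : φ * (w * c / 2 - σ) ^ 2 ≤ ((σ - p) ^ 2 + (σ - q) ^ 2) / 2 :=
    (mul_le_of_le_one_left (sq_nonneg _) hφ1).trans hr
  have h4 := mul_le_mul_of_nonneg_left h3 (show 0 ≤ c / 2 by positivity)
  rw [h1]
  linarith

/-- Replace σ by p at the cost of σ - p; then |φ|p ≤ |φ|w = |q - p|, and q - p is again controlled
by the two distances to σ. So the noise variance is comparable to the losses. -/
lemma pointwise_noise_le {p q σ w φ : ℝ} (hφw : φ * w = q - p) (hp : 0 ≤ p) (hpw : p ≤ w)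
    (h3 : φ ^ 2 ≤ 1) : φ ^ 2 * σ ^ 2 ≤ 6 * (σ - p) ^ 2 + 4 * (σ - q) ^ 2 := by
  have h1 : σ ^ 2 ≤ 2 * (σ - p) ^ 2 + 2 * p ^ 2 := by linarith [sq_nonneg (σ - 2 * p)]
  have h2 : φ ^ 2 * p ^ 2 ≤ (q - p) ^ 2 := by
    rw [← hφw, mul_pow]; gcongr
  have h4 : (q - p) ^ 2 ≤ 2 * (σ - p) ^ 2 + 2 * (σ - q) ^ 2 := by
    linarith [sq_nonneg ((σ - q) + (σ - p))]
  have h5 : φ ^ 2 * σ ^ 2 ≤ φ ^ 2 * (2 * (σ - p) ^ 2 + 2 * p ^ 2) := by gcongr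
  have h6 : φ ^ 2 * (σ - p) ^ 2 ≤ (σ - p) ^ 2 := mul_le_of_le_one_left (sq_nonneg _) h3
  linarith

/-- The pointwise inequality behind the test: `p`, `q`, `σ` are the square roots of the two
candidate densities and of the true one. -/
lemma pointwise_test_le {p q σ : ℝ} (hp : 0 ≤ p) (hq : 0 ≤ q) (hσ : 0 ≤ σ) :
    alpha / 2 * (p - q) ^ 2
      + 1 / (2 * Real.sqrt 2) * (Real.sqrt (p ^ 2 + q ^ 2) * (q - p))
      + 1 / Real.sqrt 2 * (σ ^ 2 * ((q - p) / Real.sqrt (p ^ 2 + q ^ 2)))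
      + 1 / 2 * (p ^ 2 - q ^ 2)
      + 1 / Real.sqrt 2 * (1 / 200 * ((q - p) / Real.sqrt (p ^ 2 + q ^ 2)) ^ 2 * σ ^ 2)
    ≤ 2 * (σ - p) ^ 2 - 1 / 60 * (σ - q) ^ 2 := by
  obtain ⟨c, hc⟩ : ∃ c, c = Real.sqrt 2 := ⟨_, rfl⟩
  obtain ⟨w, hw⟩ : ∃ w, w = Real.sqrt (p ^ 2 + q ^ 2) := ⟨_, rfl⟩
  have hcc : c ^ 2 = 2 := by rw [hc]; exact Real.sq_sqrt (by norm_num)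
  have hcl : 1.414 < c := by rw [hc]; exact Real.lt_sqrt_of_sq_lt (by norm_num)
  have hcu : c < 1.4143 := by rw [hc, Real.sqrt_lt' (by norm_num)]; norm_num
  have hw2 : w ^ 2 = p ^ 2 + q ^ 2 := by rw [hw]; exact Real.sq_sqrt (by positivity)
  have hw0 : 0 ≤ w := by rw [hw]; exact Real.sqrt_nonneg _
  have hci : 1 / c = c / 2 := by
    rw [div_eq_div_iff (by linarith) (by norm_num)]; linarith [sq c]
  have hci2 : 1 / (2 * c) = c / 4 := by
    rw [div_eq_div_iff (by linarith) (by norm_num)]; linarith [sq c]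
  have halpha : alpha = (1 - c / 2) / 2 := by rw [alpha, ← hc, hci]
  rw [halpha, ← hc, ← hw, hci, hci2]
  have hP := sq_nonneg (σ - p)
  have hQ := sq_nonneg (σ - q)
  rcases hw0.eq_or_lt with h0 | h0
  · have hpq : p ^ 2 + q ^ 2 = 0 := by rw [← hw2, ← h0]; norm_num
    have hp' : p = 0 := pow_eq_zero_iff two_ne_zero |>.mp (by linarith [sq_nonneg p, sq_nonneg q])
    have hq' : q = 0 := pow_eq_zero_iff two_ne_zero |>.mp (by linarith [sq_nonneg p, sq_nonneg q])
    rw [hp', hq']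
    simp only [sub_self, sub_zero, zero_div, mul_zero, add_zero, ne_eq, OfNat.ofNat_ne_zero,
      not_false_eq_true, zero_pow, zero_mul]
    linarith [sq_nonneg σ]
  obtain ⟨φ, hφ⟩ : ∃ φ, φ = (q - p) / w := ⟨_, rfl⟩
  have hφw : φ * w = q - p := by rw [hφ]; exact div_mul_cancel₀ _ h0.ne'
  rw [← hφ]
  have hqw : q ≤ w := by rw [hw]; exact Real.le_sqrt_of_sq_le (by linarith [sq_nonneg p])
  have hpw : p ≤ w := by rw [hw]; exact Real.le_sqrt_of_sq_le (by linarith [sq_nonneg q])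
  have hφ1 : φ ≤ 1 := by rw [hφ, div_le_one h0]; linarith
  have hφ2 : φ ^ 2 ≤ 1 := by
    rw [hφ, div_pow, div_le_one (by positivity), hw2]; linarith [mul_nonneg hp hq]
  have hge : p + q ≤ w * c := by
    refine abs_le_of_sq_le_sq' ?_ (mul_nonneg hw0 (by linarith)) |>.2
    rw [mul_pow, hw2, hcc]
    linarith [sq_nonneg (p - q)]
  have hmean := pointwise_mean_le hcc (by linarith) hw2 hφw hφ1 hge hσ
  have hnoise := pointwise_noise_le (σ := σ) hφw hp hpw hφ2
  -- The weights are unequal on purpose: with 2 and 2, the term α/2 · (p - q)² would exactly cancel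
  -- the gain (1/2 - √2/4)(σ - q)². With 3/2 a quarter of that gain survives; after the noise it
  -- still exceeds 1/60.
  have hdist : (p - q) ^ 2 ≤ 3 / 2 * (σ - q) ^ 2 + 3 * (σ - p) ^ 2 := by
    linarith [sq_nonneg ((σ - q) + 2 * (σ - p))]
  have h1 : (1 - c / 2) / 2 / 2 * (p - q) ^ 2
      ≤ (1 - c / 2) / 2 / 2 * (3 / 2 * (σ - q) ^ 2 + 3 * (σ - p) ^ 2) :=
    mul_le_mul_of_nonneg_left hdist (by linarith)
  have h2 : c / 2 * (1 / 200 * φ ^ 2 * σ ^ 2)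
      ≤ c / 2 * (1 / 200 * (6 * (σ - p) ^ 2 + 4 * (σ - q) ^ 2)) := by
    rw [mul_assoc (1 / 200)]
    exact mul_le_mul_of_nonneg_left (by linarith) (by linarith)
  generalize (σ - p) ^ 2 = P at *
  generalize (σ - q) ^ 2 = Q at *
  have h3 : c * P ≤ 1.4143 * P := by gcongr
  have h4 : 1.414 * P ≤ c * P := by gcongr
  have h5 : c * Q ≤ 1.4143 * Q := by gcongr
  have h6 : 1.414 * Q ≤ c * Q := by gcongr
  linarith

lemma abs_sub_div_sqrt_le_one {a b : ℝ} (ha : 0 ≤ a) (hb : 0 ≤ b) :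
    |(Real.sqrt b - Real.sqrt a) / Real.sqrt (a + b)| ≤ 1 := by
  rcases (Real.sqrt_nonneg (a + b)).eq_or_lt with h0 | h0
  · rw [← h0]; simp
  · have h1 : Real.sqrt a ≤ Real.sqrt (a + b) := Real.sqrt_le_sqrt (by linarith)
    have h2 : Real.sqrt b ≤ Real.sqrt (a + b) := Real.sqrt_le_sqrt (by linarith)
    rw [abs_le, le_div_iff₀ h0, div_le_iff₀ h0]
    constructor <;> linarith [Real.sqrt_nonneg a, Real.sqrt_nonneg b]

lemma one_div_sqrt_two_le_one : 1 / Real.sqrt 2 ≤ 1 := by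
  rw [div_le_one (by positivity), Real.one_le_sqrt]; norm_num

/-- The test on a cell where the observations are concentrated. -/
lemma cellTest_le {n : ℕ} {D R S N a b : ℝ} (hM : IsMomentTriple D R S)
    (hC : IsConcentrated n N S) (hn : 1 ≤ Real.log n) (hN0 : 0 ≤ N) (hN : N ≤ n) (hS : S ≤ n)
    (ha : 0 ≤ a) (hb : 0 ≤ b) :
    alpha / 2 * (D * (Real.sqrt a - Real.sqrt b) ^ 2) + cellTest D N a b
      ≤ 2 * cellLoss D R S a - 1 / 60 * cellLoss D R S b + 804 * Real.log n := by
  set p := Real.sqrt a with hp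
  set q := Real.sqrt b with hq
  have hpa : a = p ^ 2 := (Real.sq_sqrt ha).symm
  have hqb : b = q ^ 2 := (Real.sq_sqrt hb).symm
  set φ := (q - p) / Real.sqrt (a + b) with hφ
  have hnoise := hC.mul_sub_le hn hN0 hN hM.nonneg_right hS (abs_sub_div_sqrt_le_one ha hb)
  rw [← hp, ← hq, ← hφ] at hnoise
  -- The coefficients are those of right side minus left side in the pointwise test inequality, read
  -- as a quadratic polynomial in σ. Its nonnegativity on σ ≥ 0 is thereby integrated over the cell.
  have hquad := hM
    (2 - 1 / 60 - 1 / Real.sqrt 2 * φ - 1 / Real.sqrt 2 * (1 / 200 * φ ^ 2))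
    (-4 * p + 1 / 30 * q)
    (2 * p ^ 2 - 1 / 60 * q ^ 2 - alpha / 2 * (p - q) ^ 2
      - 1 / (2 * Real.sqrt 2) * (Real.sqrt (a + b) * (q - p)) - 1 / 2 * (p ^ 2 - q ^ 2))
    (fun σ hσ => by
      have := pointwise_test_le (Real.sqrt_nonneg a) (Real.sqrt_nonneg b) hσ
      rw [← hp, ← hq, ← hpa, ← hqb, ← hφ, hpa, hqb] at this
      rw [hpa, hqb]
      linarith)
  have h2 := mul_le_mul_of_nonneg_left hnoise
    (show (0 : ℝ) ≤ 1 / Real.sqrt 2 by positivity)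
  have h3 : 1 / Real.sqrt 2 * (804 * Real.log n) ≤ 804 * Real.log n :=
    mul_le_of_le_one_left (by linarith) one_div_sqrt_two_le_one
  unfold cellTest cellLoss
  rw [← hp, ← hq, ← hφ]
  have h4 : D * (a - b) = D * (p ^ 2 - q ^ 2) := by rw [hpa, hqb]
  have h5 : a * D = p ^ 2 * D := by rw [hpa]
  have h6 : b * D = q ^ 2 * D := by rw [hqb]
  rw [h4, h5, h6]
  linarith

lemma cellTest_neg (D N a b : ℝ) : cellTest D N b a = -cellTest D N a b := by
  unfold cellTest
  rw [add_comm b a]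
  ring

/-- A bound for the test that holds on any cell. -/
lemma cellTest_le_of_nonneg {D N a b : ℝ} (hD : 0 ≤ D) (hN : 0 ≤ N) (ha : 0 ≤ a) (hb : 0 ≤ b) :
    alpha / 2 * (D * (Real.sqrt a - Real.sqrt b) ^ 2) + cellTest D N a b
      ≤ N + 2 * (D * a) + D * b := by
  have hc := one_div_sqrt_two_le_one
  have hc0 : 0 ≤ 1 / Real.sqrt 2 := by positivity
  have hα : alpha / 2 ≤ 1 / 4 := by unfold alpha; linarith
  have hα0 : 0 ≤ alpha / 2 := by unfold alpha; linarith
  have h1 : (Real.sqrt a - Real.sqrt b) ^ 2 ≤ a + b := by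
    nlinarith [Real.sq_sqrt ha, Real.sq_sqrt hb, Real.sqrt_nonneg a, Real.sqrt_nonneg b,
      mul_nonneg (Real.sqrt_nonneg a) (Real.sqrt_nonneg b)]
  have h2 : Real.sqrt (a + b) * (Real.sqrt b - Real.sqrt a) ≤ a + b := by
    have : Real.sqrt b - Real.sqrt a ≤ Real.sqrt (a + b) := by
      linarith [Real.sqrt_nonneg a, Real.sqrt_le_sqrt (show b ≤ a + b by linarith)]
    calc _ ≤ Real.sqrt (a + b) * Real.sqrt (a + b) := by gcongr
      _ = a + b := Real.mul_self_sqrt (by linarith)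
  have h3 := (abs_le.mp (abs_sub_div_sqrt_le_one ha hb)).2
  have h4 : alpha / 2 * (D * (Real.sqrt a - Real.sqrt b) ^ 2) ≤ 1 / 4 * (D * (a + b)) := by
    gcongr
  have h5 : 1 / (2 * Real.sqrt 2) * (D * (Real.sqrt (a + b) * (Real.sqrt b - Real.sqrt a)))
      ≤ 1 / 2 * (D * (a + b)) := by
    have : 1 / (2 * Real.sqrt 2) ≤ 1 / 2 := by
      rw [← one_div_mul_one_div]; linarith
    calc _ ≤ 1 / (2 * Real.sqrt 2) * (D * (a + b)) := by gcongr
      _ ≤ _ := by gcongr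
  have h6 : 1 / Real.sqrt 2 * (N * ((Real.sqrt b - Real.sqrt a) / Real.sqrt (a + b))) ≤ N := by
    calc _ ≤ 1 / Real.sqrt 2 * (N * 1) := by gcongr
      _ ≤ 1 * (N * 1) := by gcongr
      _ = N := by ring
  unfold cellTest
  nlinarith [mul_nonneg hD ha, mul_nonneg hD hb]

/-- The histogram estimator is nearly optimal on a cell where the observations are
concentrated. -/
lemma cellLoss_estimator_le {n : ℕ} {D R S N a : ℝ} (hM : IsMomentTriple D R S)
    (hC : IsConcentrated n N S) (hn : 1 ≤ Real.log n) (hN0 : 0 ≤ N) (hN : N ≤ n) (hS : S ≤ n)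
    (ha : 0 ≤ a) :
    cellLoss D R S (N / D) ≤ 4 * cellLoss D R S a + 1618 * Real.log n := by
  have hS0 := hM.nonneg_right
  have hR0 := hM.nonneg_middle
  rcases hM.nonneg_left.eq_or_lt with hD | hD
  · unfold cellLoss
    rw [hM.middle_eq_zero hD.symm, ← hD]
    simp
    linarith
  have hdev := hC.sq_sqrt_sub_sqrt_le hn hN0 hN hS0 hS
  set P := Real.sqrt S with hP
  set Q := Real.sqrt N with hQ
  set e := Real.sqrt D with he
  have he0 : 0 < e := Real.sqrt_pos.mpr hD
  have hDe : D = e ^ 2 := (Real.sq_sqrt hD.le).symm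
  have hSP : S = P ^ 2 := (Real.sq_sqrt hS0).symm
  have hNQ : N = Q ^ 2 := (Real.sq_sqrt hN0).symm
  -- After normalising by √D, the least loss is P² - ρ² and that of N/D is this plus (Q - ρ)². Since
  -- ρ ≤ P, (P - ρ)² is at most the least loss, and Q is close to P by concentration.
  obtain ⟨ρ, hρ⟩ : ∃ ρ, R = e * ρ := ⟨R / e, by field_simp⟩
  have hρ0 : 0 ≤ ρ := by
    by_contra hneg
    nlinarith [not_le.mp hneg]
  have hP0 : 0 ≤ P := Real.sqrt_nonneg _
  have hρP : ρ ≤ P := by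
    have := hM.quadratic_nonneg (ρ / e)
    rw [hSP, hρ, hDe] at this
    have h2 : P ^ 2 - 2 * (ρ / e) * (e * ρ) + (ρ / e) ^ 2 * e ^ 2 = P ^ 2 - ρ ^ 2 := by
      field_simp; ring
    rw [h2] at this
    nlinarith
  have hmin : P ^ 2 - ρ ^ 2 ≤ cellLoss D R S a := by
    unfold cellLoss
    rw [hρ, hDe, hSP]
    nlinarith [sq_nonneg (Real.sqrt a * e - ρ), Real.sq_sqrt ha]
  have hest : cellLoss D R S (N / D) = P ^ 2 - 2 * Q * ρ + Q ^ 2 := by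
    unfold cellLoss
    rw [Real.sqrt_div' _ hD.le, ← hQ, ← he, div_mul_cancel₀ _ hD.ne', hρ, hSP, hNQ]
    field_simp
  rw [hest]
  nlinarith [sq_nonneg (Q - 2 * P + ρ),
    mul_nonneg (sub_nonneg.mpr hρP) (by linarith : 0 ≤ P + 5 * ρ)]

/-! ### Path functionals attached to a cell -/

/-- The number of transitions of the path `x` observed in `K` before time `n`. -/
def cellCount (n : ℕ) (x : ℕ → Fin d → ℝ) (K : Set (Pair d)) : ℝ :=
  ∑ i ∈ Finset.range n, K.indicator (fun _ => (1 : ℝ)) (x i, x (i + 1))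

/-- The integral `∑ i, ∫ φ (x i, y) 1_K (x i, y) dμ(y)` along the path `x`. -/
def cellIntegral (μ : Measure (Fin d → ℝ)) (n : ℕ) (x : ℕ → Fin d → ℝ) (φ : Pair d → ℝ)
    (K : Set (Pair d)) : ℝ :=
  ∑ i ∈ Finset.range n, ∫ y in unitCube d, K.indicator φ (x i, y) ∂μ

/-- The value of the histogram estimator on `K`. -/
def cellRatio (μ : Measure (Fin d → ℝ)) (n : ℕ) (x : ℕ → Fin d → ℝ) (K : Set (Pair d)) : ℝ :=
  cellCount n x K / cellIntegral μ n x (fun _ => 1) K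

/-- A nonnegative measurable function whose sections have mass at most one on the unit cube. -/
structure IsSubdensity (μ : Measure (Fin d → ℝ)) (s : Pair d → ℝ) : Prop where
  measurable : Measurable s
  nonneg : ∀ p, 0 ≤ s p
  integrable : ∀ x, Integrable (fun y => s (x, y)) (μ.restrict (unitCube d))
  integral_le_one : ∀ x, ∫ y in unitCube d, s (x, y) ∂μ ≤ 1

section Basic

variable {μ : Measure (Fin d → ℝ)} {n : ℕ} {x : ℕ → Fin d → ℝ} {K : Set (Pair d)}

lemma cellCount_nonneg : 0 ≤ cellCount n x K :=
  Finset.sum_nonneg fun _ _ => Set.indicator_nonneg (fun _ _ => zero_le_one) _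

lemma cellCount_le : cellCount n x K ≤ n := by
  calc cellCount n x K ≤ ∑ i ∈ Finset.range n, (1 : ℝ) :=
        Finset.sum_le_sum fun _ _ => Set.indicator_le_self' (fun _ _ => zero_le_one) _
    _ = n := by simp

lemma cellIntegral_nonneg {φ : Pair d → ℝ} (hφ : ∀ p, 0 ≤ φ p) :
    0 ≤ cellIntegral μ n x φ K :=
  Finset.sum_nonneg fun _ _ => integral_nonneg fun _ => Set.indicator_nonneg (fun _ _ => hφ _) _

lemma cellRatio_nonneg : 0 ≤ cellRatio μ n x K :=
  div_nonneg cellCount_nonneg (cellIntegral_nonneg fun _ => zero_le_one)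

lemma cellIntegral_mul_cellRatio_le :
    cellIntegral μ n x (fun _ => 1) K * cellRatio μ n x K ≤ cellCount n x K := by
  unfold cellRatio
  rcases eq_or_ne (cellIntegral μ n x (fun _ => 1) K) 0 with h | h
  · rw [h, zero_mul]; exact cellCount_nonneg
  · rw [mul_div_cancel₀ _ h]

lemma measurable_indicator_section {φ : Pair d → ℝ} (hφ : Measurable φ) (hK : MeasurableSet K)
    (u : Fin d → ℝ) : Measurable fun y => K.indicator φ (u, y) :=
  (hφ.indicator hK).comp measurable_prodMk_left

lemma integrable_indicator_section {ν : Measure (Fin d → ℝ)} {φ : Pair d → ℝ}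
    (hφ : Measurable φ) (hi : ∀ u, Integrable (fun y => φ (u, y)) ν) (hK : MeasurableSet K)
    (u : Fin d → ℝ) : Integrable (fun y => K.indicator φ (u, y)) ν := by
  refine (hi u).mono (measurable_indicator_section hφ hK u).aestronglyMeasurable
    (Filter.Eventually.of_forall fun y => ?_)
  exact norm_indicator_le_norm_self _ _

/-- An integrand that vanishes off the unit cube may be integrated on the unit cube. -/
lemma integral_eq_setIntegral_unitCube {F : (Fin d → ℝ) → ℝ} (h : ∀ y, y ∉ unitCube d → F y = 0) :
    ∫ y, F y ∂μ = ∫ y in unitCube d, F y ∂μ :=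
  (setIntegral_eq_integral_of_forall_compl_eq_zero h).symm

lemma notMem_of_notMem_unitCube (hK : K ⊆ unitSquare d) (u : Fin d → ℝ) {y : Fin d → ℝ}
    (hy : y ∉ unitCube d) : (u, y) ∉ K := fun h => hy (hK h).2

end Basic

namespace IsSubdensity

variable {μ : Measure (Fin d → ℝ)} {s : Pair d → ℝ} {n : ℕ} {x : ℕ → Fin d → ℝ}
  {K : Set (Pair d)}

lemma measurable_sqrt (hs : IsSubdensity μ s) : Measurable fun p => Real.sqrt (s p) :=
  hs.measurable.sqrt

lemma cellIntegral_le (hs : IsSubdensity μ s) (hK : MeasurableSet K) :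
    cellIntegral μ n x s K ≤ n := by
  calc cellIntegral μ n x s K ≤ ∑ i ∈ Finset.range n, (1 : ℝ) := by
        refine Finset.sum_le_sum fun i _ => ?_
        refine le_trans (integral_mono
          (integrable_indicator_section hs.measurable hs.integrable hK (x i))
          (hs.integrable (x i)) fun y => ?_) (hs.integral_le_one (x i))
        exact Set.indicator_le_self' (fun p _ => hs.nonneg p) _
    _ = n := by simp

variable [IsFiniteMeasure (μ.restrict (unitCube d))]

/-- The bound √s ≤ 1 + s suffices, the cube having finite measure. -/
lemma integrable_sqrt (hs : IsSubdensity μ s) (u : Fin d → ℝ) :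
    Integrable (fun y => Real.sqrt (s (u, y))) (μ.restrict (unitCube d)) := by
  refine ((integrable_const (1 : ℝ)).add (hs.integrable u)).mono
    (hs.measurable_sqrt.comp measurable_prodMk_left).aestronglyMeasurable
    (Filter.Eventually.of_forall fun y => ?_)
  have h := hs.nonneg (u, y)
  simp only [Pi.add_apply]
  rw [Real.norm_of_nonneg (Real.sqrt_nonneg _), Real.norm_of_nonneg (by positivity)]
  refine Real.sqrt_le_iff.mpr ⟨by positivity, by nlinarith⟩

/-- The polynomial inequality is applied at σ = √s(X_i, y) and integrated over the section of K,
then summed over i. -/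
lemma isMomentTriple (hs : IsSubdensity μ s) (hK : MeasurableSet K) :
    IsMomentTriple (cellIntegral μ n x (fun _ => 1) K)
      (cellIntegral μ n x (fun p => Real.sqrt (s p)) K) (cellIntegral μ n x s K) := by
  intro A B C h
  unfold cellIntegral
  rw [Finset.mul_sum, Finset.mul_sum, Finset.mul_sum, ← Finset.sum_add_distrib,
    ← Finset.sum_add_distrib]
  refine Finset.sum_nonneg fun i _ => ?_
  have h1 := integrable_indicator_section hs.measurable hs.integrable hK (x i)
  have h2 := integrable_indicator_section hs.measurable_sqrt hs.integrable_sqrt hK (x i)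
  have h3 := integrable_indicator_section (ν := μ.restrict (unitCube d))
    (measurable_const (a := (1 : ℝ))) (fun _ => integrable_const _) hK (x i)
  rw [← integral_const_mul, ← integral_const_mul, ← integral_const_mul,
    ← integral_add (h1.const_mul A) (h2.const_mul B),
    ← integral_add ((h1.const_mul A).fun_add (h2.const_mul B)) (h3.const_mul C)]
  refine integral_nonneg fun y => ?_
  by_cases hy : (x i, y) ∈ K
  · simp only [Set.indicator_of_mem hy, Pi.zero_apply]
    have := h _ (Real.sqrt_nonneg (s (x i, y)))
    rw [Real.sq_sqrt (hs.nonneg _)] at this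
    linarith
  · simp [Set.indicator_of_notMem hy]

end IsSubdensity

/-! ### Additivity over a dyadic partition -/

namespace IsDyadicPartition

variable {m : Finset (Set (Pair d))}

lemma sum_eq_of_mem (hm : IsDyadicPartition m) {K : Set (Pair d)} (hK : K ∈ m) {p : Pair d}
    (hp : p ∈ K) (F : Set (Pair d) → ℝ) (hF : ∀ K' ∈ m, p ∉ K' → F K' = 0) :
    ∑ K' ∈ m, F K' = F K :=
  Finset.sum_eq_single_of_mem K hK fun K' hK' hne =>
    hF K' hK' fun hp' => hne (hm.eq_of_mem hK' hK hp' hp)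

lemma sum_indicator_inter (hm : IsDyadicPartition m) {K : Set (Pair d)} (hK : K ⊆ unitSquare d)
    (φ : Pair d → ℝ) (p : Pair d) :
    ∑ K' ∈ m, (K ∩ K').indicator φ p = K.indicator φ p := by
  by_cases hp : p ∈ K
  · obtain ⟨K₀, ⟨hK₀, hp₀⟩, -⟩ := hm.existsUnique_mem p (hK hp)
    rw [hm.sum_eq_of_mem hK₀ hp₀ _ fun K' _ h => Set.indicator_of_notMem (fun h' => h h'.2) _,
      Set.indicator_of_mem (show p ∈ K ∩ K₀ from ⟨hp, hp₀⟩), Set.indicator_of_mem hp]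
  · rw [Set.indicator_of_notMem hp]
    exact Finset.sum_eq_zero fun K' _ => Set.indicator_of_notMem (fun h' => hp h'.1) _

lemma sum_cellCount_inter (hm : IsDyadicPartition m) {K : Set (Pair d)} (hK : K ⊆ unitSquare d)
    (n : ℕ) (x : ℕ → Fin d → ℝ) :
    ∑ K' ∈ m, cellCount n x (K ∩ K') = cellCount n x K := by
  unfold cellCount
  rw [Finset.sum_comm]
  exact Finset.sum_congr rfl fun i _ => hm.sum_indicator_inter hK _ _

lemma sum_cellCount_le (hm : IsDyadicPartition m) (n : ℕ) (x : ℕ → Fin d → ℝ) :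
    ∑ K ∈ m, cellCount n x K ≤ n := by
  calc ∑ K ∈ m, cellCount n x K = ∑ K ∈ m, cellCount n x (unitSquare d ∩ K) :=
        Finset.sum_congr rfl fun K hK => by rw [Set.inter_eq_right.mpr (hm.subset hK)]
    _ = cellCount n x (unitSquare d) := hm.sum_cellCount_inter subset_rfl n x
    _ ≤ n := cellCount_le

lemma sum_cellIntegral_inter (hm : IsDyadicPartition m) {K : Set (Pair d)}
    (hK : K ⊆ unitSquare d) (hKm : MeasurableSet K) {μ : Measure (Fin d → ℝ)} {φ : Pair d → ℝ}
    (hφ : Measurable φ) (hi : ∀ u, Integrable (fun y => φ (u, y)) (μ.restrict (unitCube d)))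
    (n : ℕ) (x : ℕ → Fin d → ℝ) :
    ∑ K' ∈ m, cellIntegral μ n x φ (K ∩ K') = cellIntegral μ n x φ K := by
  unfold cellIntegral
  rw [Finset.sum_comm]
  refine Finset.sum_congr rfl fun i _ => ?_
  rw [← integral_finsetSum _ fun K' hK' => integrable_indicator_section hφ hi
    (hKm.inter (hm.measurableSet hK')) (x i)]
  simp_rw [hm.sum_indicator_inter hK φ]

lemma sum_cellLoss_inter (hm : IsDyadicPartition m) {μ : Measure (Fin d → ℝ)}
    [IsFiniteMeasure (μ.restrict (unitCube d))] {s : Pair d → ℝ} (hs : IsSubdensity μ s)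
    {K : Set (Pair d)} (hK : K ⊆ unitSquare d) (hKm : MeasurableSet K)
    (n : ℕ) (x : ℕ → Fin d → ℝ) (a : ℝ) :
    ∑ K' ∈ m, cellLoss (cellIntegral μ n x (fun _ => 1) (K ∩ K'))
        (cellIntegral μ n x (fun p => Real.sqrt (s p)) (K ∩ K'))
        (cellIntegral μ n x s (K ∩ K')) a
      = cellLoss (cellIntegral μ n x (fun _ => 1) K)
        (cellIntegral μ n x (fun p => Real.sqrt (s p)) K) (cellIntegral μ n x s K) a := by
  unfold cellLoss
  rw [Finset.sum_add_distrib, Finset.sum_sub_distrib, ← Finset.mul_sum, ← Finset.mul_sum,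
    hm.sum_cellIntegral_inter hK hKm measurable_const (fun _ => integrable_const _),
    hm.sum_cellIntegral_inter hK hKm hs.measurable_sqrt hs.integrable_sqrt,
    hm.sum_cellIntegral_inter hK hKm hs.measurable hs.integrable]

end IsDyadicPartition

/-! ### Explicit formulas for the loss and for the test -/

section Formulas

variable {μ : Measure (Fin d → ℝ)} {n : ℕ} {x : ℕ → Fin d → ℝ} {m : Finset (Set (Pair d))}

lemma histogramEstimator_eq (hm : IsDyadicPartition m) {K : Set (Pair d)} (hK : K ∈ m)
    {p : Pair d} (hp : p ∈ K) : histogramEstimator μ n x m p = cellRatio μ n x K := by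
  unfold histogramEstimator
  rw [hm.sum_eq_of_mem hK hp _ fun K' _ h => by rw [Set.indicator_of_notMem h, mul_zero],
    Set.indicator_of_mem hp, mul_one]
  rfl

lemma hellingerSq_indicator {J : Set (Pair d)} (hJ : J ⊆ unitSquare d) {f g : Pair d → ℝ}
    {a b : ℝ} (hf : ∀ p ∈ J, f p = a) (hg : ∀ p ∈ J, g p = b) :
    hellingerSq μ n x (J.indicator f) (J.indicator g)
      = 1 / (n : ℝ) * (1 / 2 *
        (cellIntegral μ n x (fun _ => 1) J * (Real.sqrt a - Real.sqrt b) ^ 2)) := by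
  unfold hellingerSq cellIntegral
  have key : ∀ i, ∫ y, (Real.sqrt (J.indicator f (x i, y)) -
      Real.sqrt (J.indicator g (x i, y))) ^ 2 ∂μ
      = (∫ y in unitCube d, J.indicator (fun _ => (1 : ℝ)) (x i, y) ∂μ)
        * (Real.sqrt a - Real.sqrt b) ^ 2 := by
    intro i
    rw [integral_eq_setIntegral_unitCube fun y hy => by
      simp [Set.indicator_of_notMem (notMem_of_notMem_unitCube hJ (x i) hy)],
      ← integral_mul_const]
    congr 1
    ext y
    by_cases h : (x i, y) ∈ J
    · simp [Set.indicator_of_mem h, hf _ h, hg _ h]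
    · simp [Set.indicator_of_notMem h]
  simp_rw [key]
  rw [← Finset.sum_mul]
  ring

lemma testT_indicator {J : Set (Pair d)} (hJ : J ⊆ unitSquare d) {f g : Pair d → ℝ}
    {a b : ℝ} (hf : ∀ p ∈ J, f p = a) (hg : ∀ p ∈ J, g p = b) :
    testT μ n x (J.indicator f) (J.indicator g)
      = 1 / (n : ℝ) * cellTest (cellIntegral μ n x (fun _ => 1) J) (cellCount n x J) a b := by
  have h1 : ∀ i, ∫ y, Real.sqrt (J.indicator f (x i, y) + J.indicator g (x i, y)) *
        (Real.sqrt (J.indicator g (x i, y)) - Real.sqrt (J.indicator f (x i, y))) ∂μ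
      = (∫ y in unitCube d, J.indicator (fun _ => (1 : ℝ)) (x i, y) ∂μ)
        * (Real.sqrt (a + b) * (Real.sqrt b - Real.sqrt a)) := by
    intro i
    rw [integral_eq_setIntegral_unitCube fun y hy => by
      simp [Set.indicator_of_notMem (notMem_of_notMem_unitCube hJ (x i) hy)],
      ← integral_mul_const]
    congr 1
    ext y
    by_cases h : (x i, y) ∈ J
    · simp [Set.indicator_of_mem h, hf _ h, hg _ h]
    · simp [Set.indicator_of_notMem h]
  have h2 : ∀ i, (Real.sqrt (J.indicator g (x i, x (i + 1)))
        - Real.sqrt (J.indicator f (x i, x (i + 1)))) /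
          Real.sqrt (J.indicator f (x i, x (i + 1)) + J.indicator g (x i, x (i + 1)))
      = J.indicator (fun _ => (1 : ℝ)) (x i, x (i + 1))
        * ((Real.sqrt b - Real.sqrt a) / Real.sqrt (a + b)) := by
    intro i
    by_cases h : (x i, x (i + 1)) ∈ J
    · simp [Set.indicator_of_mem h, hf _ h, hg _ h]
    · simp [Set.indicator_of_notMem h]
  have h3 : ∀ i, ∫ y, (J.indicator f (x i, y) - J.indicator g (x i, y)) ∂μ
      = (∫ y in unitCube d, J.indicator (fun _ => (1 : ℝ)) (x i, y) ∂μ) * (a - b) := by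
    intro i
    rw [integral_eq_setIntegral_unitCube fun y hy => by
      simp [Set.indicator_of_notMem (notMem_of_notMem_unitCube hJ (x i) hy)],
      ← integral_mul_const]
    congr 1
    ext y
    by_cases h : (x i, y) ∈ J
    · simp [Set.indicator_of_mem h, hf _ h, hg _ h]
    · simp [Set.indicator_of_notMem h]
  unfold testT cellTest cellCount cellIntegral
  simp_rw [h1, h2, h3]
  rw [← Finset.sum_mul, ← Finset.sum_mul, ← Finset.sum_mul]
  ring

variable {s : Pair d → ℝ}

lemma sum_cellIntegral_le (hs : IsSubdensity μ s) (hm : IsDyadicPartition m) :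
    ∑ K ∈ m, cellIntegral μ n x s K ≤ n := by
  calc ∑ K ∈ m, cellIntegral μ n x s K = ∑ K ∈ m, cellIntegral μ n x s (unitSquare d ∩ K) :=
        Finset.sum_congr rfl fun K hK => by rw [Set.inter_eq_right.mpr (hm.subset hK)]
    _ = cellIntegral μ n x s (unitSquare d) :=
        hm.sum_cellIntegral_inter subset_rfl measurableSet_unitSquare hs.measurable hs.integrable
          n x
    _ ≤ n := hs.cellIntegral_le measurableSet_unitSquare

variable [IsFiniteMeasure (μ.restrict (unitCube d))]

/-- The loss of a histogram is the sum of the losses on the cells. -/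
lemma hellingerSq_histogram (hs : IsSubdensity μ s) (hm : IsDyadicPartition m)
    {a : Set (Pair d) → ℝ} (ha : ∀ K ∈ m, 0 ≤ a K) :
    hellingerSq μ n x ((unitSquare d).indicator s)
        (fun p => ∑ K ∈ m, a K * K.indicator (fun _ => (1 : ℝ)) p)
      = 1 / (2 * (n : ℝ)) * ∑ K ∈ m, cellLoss (cellIntegral μ n x (fun _ => 1) K)
        (cellIntegral μ n x (fun p => Real.sqrt (s p)) K) (cellIntegral μ n x s K) (a K) := by
  -- At each point at most one cell contributes, so the square root of the histogram is the
  -- histogram of square roots and the square expands cell by cell.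
  have hpt : ∀ p, (Real.sqrt ((unitSquare d).indicator s p)
        - Real.sqrt (∑ K ∈ m, a K * K.indicator (fun _ => (1 : ℝ)) p)) ^ 2
      = ∑ K ∈ m, (K.indicator s p
          - 2 * Real.sqrt (a K) * K.indicator (fun p => Real.sqrt (s p)) p
          + a K * K.indicator (fun _ => (1 : ℝ)) p) := by
    intro p
    by_cases hp : p ∈ unitSquare d
    · obtain ⟨K, ⟨hK, hpK⟩, -⟩ := hm.existsUnique_mem p hp
      rw [hm.sum_eq_of_mem hK hpK _ fun K' _ h => by rw [Set.indicator_of_notMem h, mul_zero],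
        hm.sum_eq_of_mem hK hpK _ fun K' _ h => by simp [Set.indicator_of_notMem h],
        Set.indicator_of_mem hp, Set.indicator_of_mem hpK, Set.indicator_of_mem hpK,
        Set.indicator_of_mem hpK, mul_one, sub_sq, Real.sq_sqrt (hs.nonneg p),
        Real.sq_sqrt (ha K hK)]
      ring
    · rw [Set.indicator_of_notMem hp, Finset.sum_eq_zero fun K hK => by
          rw [Set.indicator_of_notMem fun h => hp (hm.subset hK h), mul_zero],
        Finset.sum_eq_zero fun K hK => by
          simp [Set.indicator_of_notMem fun h => hp (hm.subset hK h)]]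
      simp
  have hint : ∀ i, ∫ y, (Real.sqrt ((unitSquare d).indicator s (x i, y))
        - Real.sqrt (∑ K ∈ m, a K * K.indicator (fun _ => (1 : ℝ)) (x i, y))) ^ 2 ∂μ
      = ∑ K ∈ m, ((∫ y in unitCube d, K.indicator s (x i, y) ∂μ)
          - 2 * Real.sqrt (a K) *
            (∫ y in unitCube d, K.indicator (fun p => Real.sqrt (s p)) (x i, y) ∂μ)
          + a K * ∫ y in unitCube d, K.indicator (fun _ => (1 : ℝ)) (x i, y) ∂μ) := by
    intro i
    simp_rw [hpt]
    rw [integral_eq_setIntegral_unitCube fun y hy => Finset.sum_eq_zero fun K hK => by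
      simp [Set.indicator_of_notMem (notMem_of_notMem_unitCube (hm.subset hK) (x i) hy)]]
    have e1 := fun K (hK : K ∈ m) => integrable_indicator_section hs.measurable hs.integrable
      (hm.measurableSet hK) (x i)
    have e2 := fun K (hK : K ∈ m) => (integrable_indicator_section hs.measurable_sqrt
      hs.integrable_sqrt (hm.measurableSet hK) (x i)).const_mul (2 * Real.sqrt (a K))
    have e3 := fun K (hK : K ∈ m) => (integrable_indicator_section
      (ν := μ.restrict (unitCube d)) (measurable_const (a := (1 : ℝ)))
      (fun _ => integrable_const _) (hm.measurableSet hK) (x i)).const_mul (a K)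
    have e12 : ∀ K ∈ m, Integrable (fun y => K.indicator s (x i, y)
        - 2 * Real.sqrt (a K) * K.indicator (fun p => Real.sqrt (s p)) (x i, y))
        (μ.restrict (unitCube d)) := fun K hK => (e1 K hK).sub (e2 K hK)
    rw [integral_finsetSum _ fun K hK => (e12 K hK).fun_add (e3 K hK)]
    refine Finset.sum_congr rfl fun K hK => ?_
    rw [integral_add (e12 K hK) (e3 K hK), integral_sub (e1 K hK) (e2 K hK),
      integral_const_mul, integral_const_mul]
  unfold hellingerSq cellLoss cellIntegral
  simp_rw [hint]
  rw [Finset.sum_comm]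
  congr 1
  refine Finset.sum_congr rfl fun K _ => ?_
  rw [Finset.sum_add_distrib, Finset.sum_sub_distrib, Finset.mul_sum, Finset.mul_sum]

/-- Twice `n` times the loss of the histogram estimator. -/
def estimatorLoss (μ : Measure (Fin d → ℝ)) (s : Pair d → ℝ) (n : ℕ) (x : ℕ → Fin d → ℝ)
    (m : Finset (Set (Pair d))) : ℝ :=
  ∑ K ∈ m, cellLoss (cellIntegral μ n x (fun _ => 1) K)
    (cellIntegral μ n x (fun p => Real.sqrt (s p)) K) (cellIntegral μ n x s K)
    (cellRatio μ n x K)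

lemma hellingerSq_histogramEstimator (hs : IsSubdensity μ s) (hm : IsDyadicPartition m) :
    hellingerSq μ n x ((unitSquare d).indicator s) (histogramEstimator μ n x m)
      = 1 / (2 * (n : ℝ)) * estimatorLoss μ s n x m :=
  hellingerSq_histogram hs hm fun _ _ => cellRatio_nonneg

/-- The loss decouples over the cells and each term is minimal at √a = R/D, so the infimum is
attained. The closed form is also what gives measurability of this infimum over an uncountable
family. -/
lemma hellingerSqDist_histograms (hs : IsSubdensity μ s) (hm : IsDyadicPartition m) :
    hellingerSqDist μ n x ((unitSquare d).indicator s) (histograms m)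
      = 1 / (2 * (n : ℝ)) * ∑ K ∈ m, cellLoss (cellIntegral μ n x (fun _ => 1) K)
        (cellIntegral μ n x (fun p => Real.sqrt (s p)) K) (cellIntegral μ n x s K)
        ((cellIntegral μ n x (fun p => Real.sqrt (s p)) K
          / cellIntegral μ n x (fun _ => 1) K) ^ 2) := by
  have hmem : (fun p => ∑ K ∈ m, (cellIntegral μ n x (fun p => Real.sqrt (s p)) K
      / cellIntegral μ n x (fun _ => 1) K) ^ 2 * K.indicator (fun _ => (1 : ℝ)) p)
      ∈ histograms m := ⟨_, fun _ _ => sq_nonneg _, rfl⟩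
  have : Nonempty (histograms m) := ⟨⟨_, hmem⟩⟩
  rw [← hellingerSq_histogram hs hm fun _ _ => sq_nonneg _]
  apply le_antisymm
  · refine ciInf_le (f := fun g : histograms m => hellingerSq μ n x ((unitSquare d).indicator s) g)
      ⟨0, ?_⟩ ⟨_, hmem⟩
    rintro _ ⟨⟨g, a, ha, rfl⟩, rfl⟩
    simp only
    rw [hellingerSq_histogram hs hm ha]
    exact mul_nonneg (by positivity) (Finset.sum_nonneg fun K hK =>
      (hs.isMomentTriple (hm.measurableSet hK)).cellLoss_nonneg (ha K hK))
  · refine le_ciInf ?_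
    rintro ⟨g, a, ha, rfl⟩
    simp only
    rw [hellingerSq_histogram hs hm ha, hellingerSq_histogram hs hm fun _ _ => sq_nonneg _]
    gcongr with K hK
    exact (hs.isMomentTriple (hm.measurableSet hK)).cellLoss_min (ha K hK)

lemma hellingerSqDist_nonneg (hs : IsSubdensity μ s) (hm : IsDyadicPartition m) :
    0 ≤ hellingerSqDist μ n x ((unitSquare d).indicator s) (histograms m) := by
  rw [hellingerSqDist_histograms hs hm]
  exact mul_nonneg (by positivity) (Finset.sum_nonneg fun K hK =>
    (hs.isMomentTriple (hm.measurableSet hK)).cellLoss_nonneg (sq_nonneg _))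

lemma estimatorLoss_nonneg (hs : IsSubdensity μ s) (hm : IsDyadicPartition m) :
    0 ≤ estimatorLoss μ s n x m :=
  Finset.sum_nonneg fun _ hK =>
    (hs.isMomentTriple (hm.measurableSet hK)).cellLoss_nonneg cellRatio_nonneg

/-- The cross term has a favourable sign and is dropped. The compensators sum to at most n, and so
do the products D · (N/D) ≤ N. -/
lemma estimatorLoss_le (hs : IsSubdensity μ s) (hm : IsDyadicPartition m) :
    estimatorLoss μ s n x m ≤ 2 * n := by
  calc estimatorLoss μ s n x m ≤ ∑ K ∈ m, (cellIntegral μ n x s K + cellCount n x K) := by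
        refine Finset.sum_le_sum fun K hK => ?_
        have h1 := (hs.isMomentTriple (n := n) (x := x) (hm.measurableSet hK)).nonneg_middle
        have h2 := cellIntegral_mul_cellRatio_le (μ := μ) (n := n) (x := x) (K := K)
        have h3 := mul_nonneg (Real.sqrt_nonneg (cellRatio μ n x K)) h1
        unfold cellLoss
        linarith
    _ ≤ n + n := by
        rw [Finset.sum_add_distrib]
        exact add_le_add (sum_cellIntegral_le hs hm) (hm.sum_cellCount_le n x)
    _ = 2 * n := by ring

/-- The loss of the best histogram is at most `1 / 2`. -/
lemma hellingerSqDist_le (hs : IsSubdensity μ s) (hm : IsDyadicPartition m) :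
    hellingerSqDist μ n x ((unitSquare d).indicator s) (histograms m) ≤ 1 / 2 := by
  rw [hellingerSqDist_histograms hs hm]
  have h : ∑ K ∈ m, cellLoss (cellIntegral μ n x (fun _ => 1) K)
        (cellIntegral μ n x (fun p => Real.sqrt (s p)) K) (cellIntegral μ n x s K)
        ((cellIntegral μ n x (fun p => Real.sqrt (s p)) K
          / cellIntegral μ n x (fun _ => 1) K) ^ 2) ≤ n := by
    refine le_trans (Finset.sum_le_sum fun K hK => ?_) (sum_cellIntegral_le hs hm (x := x))
    -- Comparison with the zero histogram, whose loss on a cell is S.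
    refine ((hs.isMomentTriple (hm.measurableSet hK)).cellLoss_min le_rfl).trans ?_
    simp [cellLoss]
  calc _ ≤ 1 / (2 * (n : ℝ)) * n := by gcongr
    _ ≤ 1 / 2 := by
      rcases Nat.eq_zero_or_pos n with h0 | h0
      · subst h0; norm_num
      · have : (n : ℝ) ≠ 0 := by positivity
        field_simp
        exact le_rfl

end Formulas

/-! ### Measurability -/

section Measurability

variable {Ω : Type*} [MeasurableSpace Ω] {X : ℕ → Ω → Fin d → ℝ} {K : Set (Pair d)}

/-- Only X 0, …, X n are required to be measurable, so that the ambient σ-algebra may be taken to be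
the one generated by the past at time n. -/
lemma measurable_cellCount (n : ℕ) (hX : ∀ i ≤ n, Measurable (X i)) (hK : MeasurableSet K) :
    Measurable fun ω => cellCount n (fun i => X i ω) K := by
  refine Finset.measurable_sum _ fun i hi => ?_
  rw [Finset.mem_range] at hi
  exact (measurable_const.indicator hK).comp ((hX i hi.le).prodMk (hX (i + 1) hi))

lemma measurable_section_integral {μ : Measure (Fin d → ℝ)} [SFinite (μ.restrict (unitCube d))]
    {φ : Pair d → ℝ} (hφ : Measurable φ) (hK : MeasurableSet K) :
    Measurable fun u => ∫ y in unitCube d, K.indicator φ (u, y) ∂μ :=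
  ((hφ.indicator hK).stronglyMeasurable.integral_prod_right').measurable

lemma measurable_cellIntegral {μ : Measure (Fin d → ℝ)} [SFinite (μ.restrict (unitCube d))]
    (n : ℕ) (hX : ∀ i < n, Measurable (X i)) {φ : Pair d → ℝ} (hφ : Measurable φ)
    (hK : MeasurableSet K) : Measurable fun ω => cellIntegral μ n (fun i => X i ω) φ K :=
  Finset.measurable_sum _ fun i hi =>
    (measurable_section_integral hφ hK).comp (hX i (Finset.mem_range.mp hi))

end Measurability

/-! ### Uniform concentration of the numbers of transitions -/

/-- The σ-algebra generated by `X 0, …, X i`. -/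
@[reducible]
def pastAlgebra {Ω : Type*} (X : ℕ → Ω → Fin d → ℝ) (i : ℕ) : MeasurableSpace Ω :=
  ⨆ (k : ℕ) (_ : k ≤ i), MeasurableSpace.comap (X k) inferInstance

lemma measurable_pastAlgebra {Ω : Type*} (X : ℕ → Ω → Fin d → ℝ) {k i : ℕ} (hk : k ≤ i) :
    Measurable[pastAlgebra X i] (X k) :=
  measurable_iff_comap_le.mpr (le_iSup₂_of_le k hk le_rfl)

namespace IsMarkovChain

variable {Ω : Type*} [MeasurableSpace Ω] {P : Measure Ω} {μ : Measure (Fin d → ℝ)}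
  {s : Pair d → ℝ} {X : ℕ → Ω → Fin d → ℝ}

lemma pastAlgebra_le (h : IsMarkovChain P μ s X) (i : ℕ) :
    pastAlgebra X i ≤ ‹MeasurableSpace Ω› :=
  iSup_le fun k => iSup_le fun _ => (h.measurable_chain k).comap_le

lemma isSubdensity (h : IsMarkovChain P μ s X) : IsSubdensity μ s := by
  have hi : ∀ x, Integrable (fun y => s (x, y)) μ := fun x => by
    refine ⟨(h.measurable_density.comp measurable_prodMk_left).aestronglyMeasurable, ?_⟩
    rw [hasFiniteIntegral_iff_ofReal (Filter.Eventually.of_forall fun y => h.density_nonneg _),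
      h.lintegral_density]
    exact ENNReal.one_lt_top
  refine ⟨h.measurable_density, h.density_nonneg, fun x => (hi x).restrict, fun x => ?_⟩
  calc ∫ y in unitCube d, s (x, y) ∂μ ≤ ∫ y, s (x, y) ∂μ :=
        setIntegral_le_integral (hi x) (Filter.Eventually.of_forall fun y => h.density_nonneg _)
    _ = 1 := by
        rw [integral_eq_lintegral_of_nonneg_ae
          (Filter.Eventually.of_forall fun y => h.density_nonneg _) (hi x).1,
          h.lintegral_density, ENNReal.toReal_one]

variable [IsProbabilityMeasure P]

/-- The compensator of the indicator of a transition in a dyadic cube. -/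
lemma integral_mul_indicator (h : IsMarkovChain P μ s X) {j : ℕ} {K : Set (Pair d)}
    (hK : K ∈ dyadicCubes d j) (i : ℕ) {G : Ω → ℝ}
    (hG : Measurable[pastAlgebra X i] G) {c : ℝ}
    (hc : ∀ ω, |G ω| ≤ c) :
    ∫ ω, G ω * K.indicator (fun _ => (1 : ℝ)) (X i ω, X (i + 1) ω) ∂P
      = ∫ ω, G ω * ∫ y in unitCube d, K.indicator s (X i ω, y) ∂μ ∂P := by
  classical
  obtain ⟨K₁, K₂, hK₁, hK₂, hKe⟩ := exists_prod_of_mem_dyadicCubes hK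
  have hK₂s : K₂ ⊆ unitCube d := by
    obtain ⟨p, hp⟩ := nonempty_of_mem_dyadicCubes hK
    intro y hy
    rw [hKe] at hp
    have : ((p.1, y) : Pair d) ∈ K := by rw [hKe]; exact ⟨hp.1, hy⟩
    exact (subset_unitSquare hK this).2
  have hFle := h.pastAlgebra_le i
  -- The Markov property speaks of the next state only. As K is a product, the condition on the
  -- current state is absorbed into the past-measurable factor.
  let G' : Ω → ℝ := fun ω => G ω * K₁.indicator (fun _ => (1 : ℝ)) (X i ω)
  have hG' : Measurable[pastAlgebra X i] G' :=
    hG.mul ((measurable_const.indicator hK₁).comp (measurable_pastAlgebra X le_rfl))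
  let B : Ω → ℝ := (X (i + 1) ⁻¹' K₂).indicator fun _ => (1 : ℝ)
  have hBm : MeasurableSet (X (i + 1) ⁻¹' K₂) := h.measurable_chain (i + 1) hK₂
  have hB : Integrable B P := (integrable_const (1 : ℝ)).indicator hBm
  have hc0 : ∀ ω, ‖G' ω‖ ≤ c := fun ω => by
    rw [norm_mul]
    refine (mul_le_of_le_one_right (norm_nonneg _) ?_).trans (hc ω)
    refine (norm_indicator_le_norm_self _ _).trans (by simp)
  have hGB : Integrable (G' * B) P :=
    hB.bdd_mul (hG'.mono hFle le_rfl).aestronglyMeasurable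
      (Filter.Eventually.of_forall hc0)
  calc ∫ ω, G ω * K.indicator (fun _ => (1 : ℝ)) (X i ω, X (i + 1) ω) ∂P
      = ∫ ω, (G' * B) ω ∂P := by
        congr 1
        ext ω
        simp only [G', B, Pi.mul_apply, hKe, Set.indicator_apply, Set.mem_prod, Set.mem_preimage]
        split_ifs <;> simp_all
    _ = ∫ ω, (P[G' * B | pastAlgebra X i]) ω ∂P := (integral_condExp hFle).symm
    _ = ∫ ω, G' ω * ∫ y in K₂, s (X i ω, y) ∂μ ∂P := by
        refine integral_congr_ae ?_
        filter_upwards [condExp_mul_of_stronglyMeasurable_left hG'.stronglyMeasurable hGB hB,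
          h.markov i K₂ hK₂] with ω h1 h2
        rw [h1, Pi.mul_apply]
        exact congrArg (G' ω * ·) h2
    _ = _ := by
        congr 1
        ext ω
        simp only [G', mul_assoc]
        congr 1
        by_cases hω : X i ω ∈ K₁
        · rw [Set.indicator_of_mem hω, one_mul]
          have : ∀ y, K.indicator s (X i ω, y) = K₂.indicator (fun y => s (X i ω, y)) y := by
            intro y
            simp only [hKe, Set.indicator_apply, Set.mem_prod, hω, true_and]
          simp_rw [this]
          rw [setIntegral_indicator hK₂, Set.inter_eq_right.mpr hK₂s]
        · rw [Set.indicator_of_notMem hω, zero_mul]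
          have : ∀ y, K.indicator s (X i ω, y) = 0 := by
            intro y
            simp only [hKe, Set.indicator_apply, Set.mem_prod, hω, false_and, if_false]
          simp [this]

variable [IsFiniteMeasure (μ.restrict (unitCube d))]

lemma exists_bound {Φ : ℝ × ℝ → ℝ} (hΦ : Continuous Φ) (a : ℝ) :
    ∃ C, ∀ u v, 0 ≤ u → u ≤ a → 0 ≤ v → v ≤ a → |Φ (u, v)| ≤ C := by
  obtain ⟨C, hC⟩ := (isCompact_Icc (a := ((0 : ℝ), (0 : ℝ)))
    (b := (a, a))).exists_bound_of_continuousOn hΦ.continuousOn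
  exact ⟨C, fun u v h1 h2 h3 h4 => hC (u, v) ⟨⟨h1, h3⟩, ⟨h2, h4⟩⟩⟩

lemma integrable_functional (h : IsMarkovChain P μ s X) {K : Set (Pair d)}
    (hK : MeasurableSet K) {Φ : ℝ × ℝ → ℝ} (hΦ : Continuous Φ) (k : ℕ) :
    Integrable (fun ω => Φ (cellCount k (fun i => X i ω) K,
      cellIntegral μ k (fun i => X i ω) s K)) P := by
  obtain ⟨C, hC⟩ := exists_bound hΦ k
  refine Integrable.of_bound (C := C) ?_ (Filter.Eventually.of_forall fun ω =>
    hC _ _ cellCount_nonneg cellCount_le (cellIntegral_nonneg h.density_nonneg)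
      (h.isSubdensity.cellIntegral_le hK))
  exact (hΦ.measurable.comp ((measurable_cellCount k (fun i _ => h.measurable_chain i) hK).prodMk
    (measurable_cellIntegral k (fun i _ => h.measurable_chain i)
      h.measurable_density hK))).aestronglyMeasurable

/-- A function of the number of transitions and of its compensator whose drift is bounded by `c`
times the increment of the compensator. -/
lemma integral_functional_le (h : IsMarkovChain P μ s X) {j : ℕ} {K : Set (Pair d)}
    (hK : K ∈ dyadicCubes d j) {Φ : ℝ × ℝ → ℝ} (hΦ : Continuous Φ) {c : ℝ}
    (hdrift : ∀ u v p : ℝ, 0 ≤ u → 0 ≤ v → 0 ≤ p → p ≤ 1 →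
      Φ (u, v + p) + (Φ (u + 1, v + p) - Φ (u, v + p)) * p ≤ Φ (u, v) + c * p) (k : ℕ) :
    ∫ ω, Φ (cellCount k (fun i => X i ω) K, cellIntegral μ k (fun i => X i ω) s K) ∂P
      ≤ Φ (0, 0) + c * ∫ ω, cellIntegral μ k (fun i => X i ω) s K ∂P := by
  have hKm := measurableSet_of_mem_dyadicCubes hK
  have hs := h.isSubdensity
  induction k with
  | zero => simp [cellCount, cellIntegral]
  | succ k ih =>
    let N : Ω → ℝ := fun ω => cellCount k (fun i => X i ω) K
    let S : Ω → ℝ := fun ω => cellIntegral μ k (fun i => X i ω) s K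
    let p : Ω → ℝ := fun ω => ∫ y in unitCube d, K.indicator s (X k ω, y) ∂μ
    let ξ : Ω → ℝ := fun ω => K.indicator (fun _ => (1 : ℝ)) (X k ω, X (k + 1) ω)
    have hp0 : ∀ ω, 0 ≤ p ω := fun ω =>
      integral_nonneg fun y => Set.indicator_nonneg (fun q _ => hs.nonneg q) _
    have hp1 : ∀ ω, p ω ≤ 1 := fun ω =>
      (integral_mono (integrable_indicator_section hs.measurable hs.integrable hKm (X k ω))
        (hs.integrable (X k ω)) fun y => Set.indicator_le_self' (fun q _ => hs.nonneg q) _).trans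
        (hs.integral_le_one (X k ω))
    have hN0 : ∀ ω, 0 ≤ N ω := fun ω => cellCount_nonneg
    have hS0 : ∀ ω, 0 ≤ S ω := fun ω => cellIntegral_nonneg hs.nonneg
    have hN1 : ∀ ω, N ω ≤ k := fun ω => cellCount_le
    have hS1 : ∀ ω, S ω ≤ k := fun ω => hs.cellIntegral_le hKm
    have hNs : ∀ ω, cellCount (k + 1) (fun i => X i ω) K = N ω + ξ ω := fun ω =>
      Finset.sum_range_succ _ _
    have hSs : ∀ ω, cellIntegral μ (k + 1) (fun i => X i ω) s K = S ω + p ω := fun ω =>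
      Finset.sum_range_succ _ _
    have hFle := h.pastAlgebra_le k
    have hXF : ∀ i ≤ k, Measurable[pastAlgebra X k] (X i) := fun i hi =>
      measurable_pastAlgebra X hi
    have hNF : Measurable[pastAlgebra X k] N :=
      @measurable_cellCount d Ω (pastAlgebra X k) X K k hXF hKm
    have hSF : Measurable[pastAlgebra X k] S :=
      @measurable_cellIntegral d Ω (pastAlgebra X k) X K μ _ k (fun i hi => hXF i hi.le) s
        h.measurable_density hKm
    have hpF : Measurable[pastAlgebra X k] p :=
      (measurable_section_integral h.measurable_density hKm).comp (hXF k le_rfl)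
    -- Since ξ is 0 or 1, the new value of Φ is U + Vξ. Both U and V are known at time k, because
    -- the compensator increment p depends on X k only, so ξ may be replaced by p under the
    -- expectation.
    let U : Ω → ℝ := fun ω => Φ (N ω, S ω + p ω)
    let V : Ω → ℝ := fun ω => Φ (N ω + 1, S ω + p ω) - Φ (N ω, S ω + p ω)
    have hUF : Measurable[pastAlgebra X k] U := hΦ.measurable.comp (hNF.prodMk (hSF.add hpF))
    have hVF : Measurable[pastAlgebra X k] V :=
      (hΦ.measurable.comp ((hNF.add measurable_const).prodMk (hSF.add hpF))).sub hUF
    obtain ⟨C, hC⟩ := exists_bound hΦ (k + 1)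
    have hUb : ∀ ω, |U ω| ≤ C := fun ω => hC _ _ (hN0 ω) (by linarith [hN1 ω])
      (add_nonneg (hS0 ω) (hp0 ω)) (add_le_add (hS1 ω) (hp1 ω))
    have hVb : ∀ ω, |V ω| ≤ C + C := fun ω => (abs_sub _ _).trans (add_le_add
      (hC _ _ (by linarith [hN0 ω]) (by linarith [hN1 ω])
        (add_nonneg (hS0 ω) (hp0 ω)) (add_le_add (hS1 ω) (hp1 ω))) (hUb ω))
    have hUi : Integrable U P := Integrable.of_bound
      (hUF.mono hFle le_rfl).aestronglyMeasurable C (Filter.Eventually.of_forall hUb)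
    have hVi : Integrable V P := Integrable.of_bound
      (hVF.mono hFle le_rfl).aestronglyMeasurable (C + C) (Filter.Eventually.of_forall hVb)
    have hpi : Integrable p P := Integrable.of_bound
      (hpF.mono hFle le_rfl).aestronglyMeasurable 1 (Filter.Eventually.of_forall fun ω => by
        rw [Real.norm_of_nonneg (hp0 ω)]; exact hp1 ω)
    have hVp : Integrable (fun ω => V ω * p ω) P :=
      hpi.bdd_mul (hVF.mono hFle le_rfl).aestronglyMeasurable
        (Filter.Eventually.of_forall hVb)
    have hξm : Measurable ξ := (measurable_const.indicator hKm).comp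
      ((h.measurable_chain k).prodMk (h.measurable_chain (k + 1)))
    have hξi : Integrable ξ P := Integrable.of_bound hξm.aestronglyMeasurable 1
      (Filter.Eventually.of_forall fun ω => (norm_indicator_le_norm_self _ _).trans (by simp))
    have hVξ : Integrable (fun ω => V ω * ξ ω) P :=
      hξi.bdd_mul (hVF.mono hFle le_rfl).aestronglyMeasurable
        (Filter.Eventually.of_forall hVb)
    have hΦi := h.integrable_functional hKm hΦ k
    have hSi : Integrable S P := h.integrable_functional hKm continuous_snd k
    calc ∫ ω, Φ (cellCount (k + 1) (fun i => X i ω) K,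
          cellIntegral μ (k + 1) (fun i => X i ω) s K) ∂P
        = ∫ ω, (U ω + V ω * ξ ω) ∂P := by
          congr 1
          ext ω
          rw [hNs, hSs]
          by_cases hω : (X k ω, X (k + 1) ω) ∈ K
          · have : ξ ω = 1 := Set.indicator_of_mem hω _
            simp only [this, U, V]
            ring
          · have : ξ ω = 0 := Set.indicator_of_notMem hω _
            simp [this, U]
      _ = ∫ ω, (U ω + V ω * p ω) ∂P := by
          rw [integral_add hUi hVξ, integral_add hUi hVp,
            h.integral_mul_indicator hK k hVF hVb]
      _ ≤ ∫ ω, (Φ (N ω, S ω) + c * p ω) ∂P :=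
          integral_mono (hUi.add hVp) (hΦi.add (hpi.const_mul c))
            fun ω => hdrift _ _ _ (hN0 ω) (hS0 ω) (hp0 ω) (hp1 ω)
      _ = ∫ ω, Φ (N ω, S ω) ∂P + c * ∫ ω, p ω ∂P := by
          rw [integral_add hΦi (hpi.const_mul c), integral_const_mul]
      _ ≤ (Φ (0, 0) + c * ∫ ω, S ω ∂P) + c * ∫ ω, p ω ∂P := by gcongr
      _ = _ := by
          simp_rw [hSs]
          rw [integral_add hSi hpi]
          ring

end IsMarkovChain

lemma isDyadicPartition_dyadicCubes (d j : ℕ) : IsDyadicPartition (dyadicCubes d j) where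
  exists_level _ hK := ⟨j, hK⟩
  existsUnique_mem p hp := ⟨dyadicCell j p,
    ⟨dyadicCell_mem_dyadicCubes hp, mem_dyadicCell_self hp⟩, fun _ hK => eq_dyadicCell hK.1 hK.2⟩

namespace IsMarkovChain

variable {Ω : Type*} [MeasurableSpace Ω] {P : Measure Ω} {μ : Measure (Fin d → ℝ)}
  {s : Pair d → ℝ} {X : ℕ → Ω → Fin d → ℝ} [IsProbabilityMeasure P]
  [IsFiniteMeasure (μ.restrict (unitCube d))]

/-- A union bound over all the dyadic cubes of a given level, whose cost does not depend on the
number of these cubes. -/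
lemma measureReal_exists_le (h : IsMarkovChain P μ s X) (n j : ℕ) {Φ : ℝ × ℝ → ℝ}
    (hΦ : Continuous Φ) (hΦ00 : Φ (0, 0) = 0) (hΦ0 : ∀ u v, 0 ≤ u → 0 ≤ v → 0 ≤ Φ (u, v))
    {c : ℝ} (hc : 0 ≤ c)
    (hdrift : ∀ u v p : ℝ, 0 ≤ u → 0 ≤ v → 0 ≤ p → p ≤ 1 →
      Φ (u, v + p) + (Φ (u + 1, v + p) - Φ (u, v + p)) * p ≤ Φ (u, v) + c * p)
    {ε : ℝ} (hε : 0 < ε) :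
    P.real {ω | ∃ K ∈ dyadicCubes d j, ε ≤ Φ (cellCount n (fun i => X i ω) K,
      cellIntegral μ n (fun i => X i ω) s K)} ≤ c * n / ε := by
  have hset : {ω | ∃ K ∈ dyadicCubes d j, ε ≤ Φ (cellCount n (fun i => X i ω) K,
      cellIntegral μ n (fun i => X i ω) s K)}
      = ⋃ K ∈ dyadicCubes d j, {ω | ε ≤ Φ (cellCount n (fun i => X i ω) K,
      cellIntegral μ n (fun i => X i ω) s K)} := by
    ext ω; simp
  have hpart := isDyadicPartition_dyadicCubes d j
  have hSi : ∀ K ∈ dyadicCubes d j,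
      Integrable (fun ω => cellIntegral μ n (fun i => X i ω) s K) P := fun K hK =>
    h.integrable_functional (measurableSet_of_mem_dyadicCubes hK) continuous_snd n
  rw [hset, le_div_iff₀ hε]
  calc P.real (⋃ K ∈ dyadicCubes d j, {ω | ε ≤ Φ (cellCount n (fun i => X i ω) K,
        cellIntegral μ n (fun i => X i ω) s K)}) * ε
      ≤ (∑ K ∈ dyadicCubes d j, P.real {ω | ε ≤ Φ (cellCount n (fun i => X i ω) K,
        cellIntegral μ n (fun i => X i ω) s K)}) * ε := by
        gcongr
        exact measureReal_biUnion_finset_le _ _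
    _ = ∑ K ∈ dyadicCubes d j, ε * P.real {ω | ε ≤ Φ (cellCount n (fun i => X i ω) K,
        cellIntegral μ n (fun i => X i ω) s K)} := by
        rw [Finset.sum_mul]; simp_rw [mul_comm]
    _ ≤ ∑ K ∈ dyadicCubes d j, c * ∫ ω, cellIntegral μ n (fun i => X i ω) s K ∂P := by
        refine Finset.sum_le_sum fun K hK => ?_
        have h1 := h.integral_functional_le hK hΦ hdrift n
        rw [hΦ00, zero_add] at h1
        refine le_trans (mul_meas_ge_le_integral_of_nonneg (Filter.Eventually.of_forall fun ω =>
          hΦ0 _ _ cellCount_nonneg (cellIntegral_nonneg h.density_nonneg))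
          (h.integrable_functional (measurableSet_of_mem_dyadicCubes hK) hΦ n) ε) h1
    _ = c * ∫ ω, ∑ K ∈ dyadicCubes d j, cellIntegral μ n (fun i => X i ω) s K ∂P := by
        rw [integral_finsetSum _ hSi, Finset.mul_sum]
    -- The cubes of one level partition the square, so their compensators sum to at most n: the
    -- number of cubes disappears here.
    _ ≤ c * ∫ _, (n : ℝ) ∂P := by
        gcongr
        · exact integrable_finsetSum _ hSi
        · exact integrable_const _
        · exact fun ω => sum_cellIntegral_le h.isSubdensity hpart
    _ = c * n := by simp

end IsMarkovChain

/-- The process e^{lN - cS} is a supermartingale because 1 + cp ≤ e^{cp}. Subtracting e^{-cS} makes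
the functional vanish at the origin, and this correction adds a drift of at most cp. -/
lemma drift_upper {l c u v p : ℝ} (hc : c = Real.exp l - 1) (hc0 : 0 ≤ c) (hv : 0 ≤ v)
    (hp : 0 ≤ p) :
    (Real.exp (l * u) - 1) * Real.exp (-(c * (v + p)))
      + ((Real.exp (l * (u + 1)) - 1) * Real.exp (-(c * (v + p)))
        - (Real.exp (l * u) - 1) * Real.exp (-(c * (v + p)))) * p
      ≤ (Real.exp (l * u) - 1) * Real.exp (-(c * v)) + c * p := by
  have h1 : Real.exp (l * (u + 1)) = Real.exp (l * u) * (1 + c) := by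
    rw [mul_add, mul_one, Real.exp_add, hc]; ring
  have h2 : Real.exp (-(c * (v + p))) = Real.exp (-(c * v)) * Real.exp (-(c * p)) := by
    rw [← Real.exp_add]; ring_nf
  have h3 : Real.exp (-(c * p)) * (1 + c * p) ≤ 1 := by
    have := Real.add_one_le_exp (c * p)
    calc Real.exp (-(c * p)) * (1 + c * p) ≤ Real.exp (-(c * p)) * Real.exp (c * p) := by
          gcongr; linarith
      _ = 1 := by rw [← Real.exp_add]; simp
  have h4 : 1 - c * p ≤ Real.exp (-(c * p)) := Real.one_sub_le_exp_neg _
  have h5 : Real.exp (-(c * v)) ≤ 1 := Real.exp_le_one_iff.mpr (by nlinarith)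
  have h6 : 0 < Real.exp (-(c * v)) := Real.exp_pos _
  rw [h1, h2]
  have e1 : Real.exp (l * u) * Real.exp (-(c * v)) * (Real.exp (-(c * p)) * (1 + c * p))
      ≤ Real.exp (l * u) * Real.exp (-(c * v)) * 1 := by gcongr
  have e2 : Real.exp (-(c * v)) * (1 - Real.exp (-(c * p))) ≤ c * p := by
    calc Real.exp (-(c * v)) * (1 - Real.exp (-(c * p))) ≤ Real.exp (-(c * v)) * (c * p) := by
          gcongr; linarith
      _ ≤ 1 * (c * p) := by gcongr
      _ = c * p := one_mul _
  linarith

/-- The mirror image for lower deviations: e^{cS - lN} is a supermartingale because 1 - cp ≤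
e^{-cp}, and subtracting e^{-lN} adds a drift e^{-lu}cp ≤ cp. -/
lemma drift_lower {l c u v p : ℝ} (hc : c = 1 - Real.exp (-l)) (hc0 : 0 ≤ c) (hl : 0 ≤ l)
    (hu : 0 ≤ u) (hp : 0 ≤ p) :
    (Real.exp (c * (v + p)) - 1) * Real.exp (-(l * u))
      + ((Real.exp (c * (v + p)) - 1) * Real.exp (-(l * (u + 1)))
        - (Real.exp (c * (v + p)) - 1) * Real.exp (-(l * u))) * p
      ≤ (Real.exp (c * v) - 1) * Real.exp (-(l * u)) + c * p := by
  have h1 : Real.exp (-(l * (u + 1))) = Real.exp (-(l * u)) * (1 - c) := by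
    rw [hc, mul_add, mul_one, neg_add, Real.exp_add]; ring
  have h2 : Real.exp (c * (v + p)) = Real.exp (c * v) * Real.exp (c * p) := by
    rw [← Real.exp_add]; ring_nf
  have h3 : Real.exp (c * p) * (1 - c * p) ≤ 1 := by
    have := Real.one_sub_le_exp_neg (c * p)
    calc Real.exp (c * p) * (1 - c * p) ≤ Real.exp (c * p) * Real.exp (-(c * p)) := by
          gcongr
      _ = 1 := by rw [← Real.exp_add]; simp
  have h5 : Real.exp (-(l * u)) ≤ 1 := Real.exp_le_one_iff.mpr (by nlinarith)
  rw [h1, h2]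
  have e1 : Real.exp (-(l * u)) * Real.exp (c * v) * (Real.exp (c * p) * (1 - c * p))
      ≤ Real.exp (-(l * u)) * Real.exp (c * v) * 1 := by gcongr
  have e2 : Real.exp (-(l * u)) * (c * p) ≤ 1 * (c * p) := by gcongr
  linarith

namespace IsMarkovChain

variable {Ω : Type*} [MeasurableSpace Ω] {P : Measure Ω} {μ : Measure (Fin d → ℝ)}
  {s : Pair d → ℝ} {X : ℕ → Ω → Fin d → ℝ} [IsProbabilityMeasure P]
  [IsFiniteMeasure (μ.restrict (unitCube d))]

/-- With l = 1/k one has e^l - 1 ≤ l + l², so the deviation multiplied by l gives lN - (e^l - 1)S ≥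
t. The functional is then at least e^t - 1, and Markov's inequality applies. -/
lemma measureReal_upper_le (h : IsMarkovChain P μ s X) (n j : ℕ) {k : ℕ} (hk : 1 ≤ k) {t : ℝ}
    (ht : 0 < t) :
    P.real {ω | ∃ K ∈ dyadicCubes d j, cellIntegral μ n (fun i => X i ω) s K / k + k * t
      < cellCount n (fun i => X i ω) K - cellIntegral μ n (fun i => X i ω) s K}
      ≤ 2 * n / (Real.exp t - 1) := by
  have hk' : (1 : ℝ) ≤ k := by exact_mod_cast hk
  set l : ℝ := 1 / k with hl
  have hkl : (k : ℝ) * l = 1 := by rw [hl]; field_simp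
  have hl0 : 0 < l := by positivity
  have hl1 : l ≤ 1 := by rw [hl, div_le_one (by positivity)]; exact hk'
  have hexp := Real.abs_exp_sub_one_sub_id_le (x := l) (by rwa [abs_of_pos hl0])
  have hc2 : Real.exp l - 1 ≤ l + l ^ 2 := by linarith [(abs_le.mp hexp).2]
  have hc0 : 0 ≤ Real.exp l - 1 := by linarith [Real.add_one_le_exp l]
  have hle : Real.exp l - 1 ≤ 2 := by nlinarith
  have hε : 0 < Real.exp t - 1 := by linarith [Real.add_one_lt_exp ht.ne']
  have hmain := h.measureReal_exists_le n j
    (Φ := fun q => (Real.exp (l * q.1) - 1) * Real.exp (-((Real.exp l - 1) * q.2)))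
    (by fun_prop) (by simp)
    (fun u v hu hv => mul_nonneg (by
      have : 1 ≤ Real.exp (l * u) := Real.one_le_exp (by positivity)
      linarith) (Real.exp_pos _).le) hc0
    (fun u v p hu hv hp hp1 => drift_upper rfl hc0 hv hp) hε
  refine (measureReal_mono ?_).trans (hmain.trans (by gcongr))
  rintro ω ⟨K, hK, hlt⟩
  refine ⟨K, hK, ?_⟩
  simp only
  have hS0 : 0 ≤ cellIntegral μ n (fun i => X i ω) s K := cellIntegral_nonneg h.density_nonneg
  set N := cellCount n (fun i => X i ω) K
  set S := cellIntegral μ n (fun i => X i ω) s K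
  have h1 : t ≤ l * N - (Real.exp l - 1) * S := by
    have h2 := mul_lt_mul_of_pos_left hlt hl0
    have h3 : l * (S / k + k * t) = l ^ 2 * S + (k * l) * t := by rw [hl]; ring
    rw [h3, hkl] at h2
    have h4 : (Real.exp l - 1) * S ≤ (l + l ^ 2) * S := by gcongr
    linarith
  have h5 : (Real.exp (l * N) - 1) * Real.exp (-((Real.exp l - 1) * S))
      = Real.exp (l * N - (Real.exp l - 1) * S) - Real.exp (-((Real.exp l - 1) * S)) := by
    rw [sub_mul, ← Real.exp_add, one_mul, sub_eq_add_neg (l * N)]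
  rw [h5]
  exact sub_le_sub (Real.exp_le_exp.mpr h1) (Real.exp_le_one_iff.mpr (by
    have := mul_nonneg hc0 hS0
    linarith))

/-- The same argument with l = 1/k and 1 - e^{-l} ≥ l - l². -/
lemma measureReal_lower_le (h : IsMarkovChain P μ s X) (n j : ℕ) {k : ℕ} (hk : 1 ≤ k) {t : ℝ}
    (ht : 0 < t) :
    P.real {ω | ∃ K ∈ dyadicCubes d j, cellIntegral μ n (fun i => X i ω) s K / k + k * t
      < cellIntegral μ n (fun i => X i ω) s K - cellCount n (fun i => X i ω) K}
      ≤ 2 * n / (Real.exp t - 1) := by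
  have hk' : (1 : ℝ) ≤ k := by exact_mod_cast hk
  set l : ℝ := 1 / k with hl
  have hkl : (k : ℝ) * l = 1 := by rw [hl]; field_simp
  have hl0 : 0 < l := by positivity
  have hl1 : l ≤ 1 := by rw [hl, div_le_one (by positivity)]; exact hk'
  have hexp := Real.abs_exp_sub_one_sub_id_le (x := -l) (by rwa [abs_neg, abs_of_pos hl0])
  have hc2 : l - l ^ 2 ≤ 1 - Real.exp (-l) := by linarith [(abs_le.mp hexp).2]
  have hc0 : 0 ≤ 1 - Real.exp (-l) := by nlinarith
  have hle : 1 - Real.exp (-l) ≤ 2 := by linarith [Real.exp_pos (-l)]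
  have hε : 0 < Real.exp t - 1 := by linarith [Real.add_one_lt_exp ht.ne']
  have hmain := h.measureReal_exists_le n j
    (Φ := fun q => (Real.exp ((1 - Real.exp (-l)) * q.2) - 1) * Real.exp (-(l * q.1)))
    (by fun_prop) (by simp)
    (fun u v hu hv => mul_nonneg (by
      have : 1 ≤ Real.exp ((1 - Real.exp (-l)) * v) := Real.one_le_exp (mul_nonneg hc0 hv)
      linarith) (Real.exp_pos _).le) hc0
    (fun u v p hu hv hp hp1 => drift_lower rfl hc0 hl0.le hu hp) hε
  refine (measureReal_mono ?_).trans (hmain.trans (by gcongr))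
  rintro ω ⟨K, hK, hlt⟩
  refine ⟨K, hK, ?_⟩
  simp only
  have hS0 : 0 ≤ cellIntegral μ n (fun i => X i ω) s K := cellIntegral_nonneg h.density_nonneg
  have hN0 : 0 ≤ cellCount n (fun i => X i ω) K := cellCount_nonneg
  set N := cellCount n (fun i => X i ω) K
  set S := cellIntegral μ n (fun i => X i ω) s K
  have h1 : t ≤ (1 - Real.exp (-l)) * S - l * N := by
    have h2 := mul_lt_mul_of_pos_left hlt hl0
    have h3 : l * (S / k + k * t) = l ^ 2 * S + (k * l) * t := by rw [hl]; ring
    rw [h3, hkl] at h2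
    have h4 : (l - l ^ 2) * S ≤ (1 - Real.exp (-l)) * S := by gcongr
    linarith
  have h5 : (Real.exp ((1 - Real.exp (-l)) * S) - 1) * Real.exp (-(l * N))
      = Real.exp ((1 - Real.exp (-l)) * S - l * N) - Real.exp (-(l * N)) := by
    rw [sub_mul, ← Real.exp_add, one_mul, ← sub_eq_add_neg]
  rw [h5]
  exact sub_le_sub (Real.exp_le_exp.mpr h1) (Real.exp_le_one_iff.mpr (by
    have := mul_nonneg hl0.le hN0
    linarith))

end IsMarkovChain

/-- The numbers of transitions are concentrated in all the dyadic cubes of level at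
most `2 n`. -/
def IsGoodPath (μ : Measure (Fin d → ℝ)) (s : Pair d → ℝ) (n : ℕ) (x : ℕ → Fin d → ℝ) : Prop :=
  ∀ j ≤ 2 * n, ∀ K ∈ dyadicCubes d j, IsConcentrated n (cellCount n x K) (cellIntegral μ n x s K)

lemma IsMarkovChain.measureReal_not_isGoodPath_le {Ω : Type*} [MeasurableSpace Ω] {P : Measure Ω}
    [IsProbabilityMeasure P] {μ : Measure (Fin d → ℝ)} [IsFiniteMeasure (μ.restrict (unitCube d))]
    {s : Pair d → ℝ} {X : ℕ → Ω → Fin d → ℝ} (h : IsMarkovChain P μ s X) {n : ℕ} (hn : 3 < n) :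
    P.real {ω | ¬ IsGoodPath μ s n fun i => X i ω} ≤ 24 / n := by
  have hn' : (4 : ℝ) ≤ n := by exact_mod_cast hn
  have hlog : 0 < Real.log n := Real.log_pos (by linarith)
  have hexp : Real.exp (4 * Real.log n) = (n : ℝ) ^ 4 := by
    rw [mul_comm, Real.exp_mul, Real.exp_log (by positivity)]
    exact_mod_cast rfl
  have hsub : {ω | ¬ IsGoodPath μ s n fun i => X i ω} ⊆
      ⋃ j ∈ Finset.range (2 * n + 1), ⋃ k ∈ Finset.Icc 1 n,
        ({ω | ∃ K ∈ dyadicCubes d j,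
            cellIntegral μ n (fun i => X i ω) s K / k + k * (4 * Real.log n)
            < cellCount n (fun i => X i ω) K - cellIntegral μ n (fun i => X i ω) s K} ∪
          {ω | ∃ K ∈ dyadicCubes d j,
            cellIntegral μ n (fun i => X i ω) s K / k + k * (4 * Real.log n)
            < cellIntegral μ n (fun i => X i ω) s K - cellCount n (fun i => X i ω) K}) := by
    intro ω hω
    simp only [IsGoodPath, IsConcentrated, Set.mem_ofPred_eq, not_forall] at hω
    obtain ⟨j, hj, K, hK, k, hk1, hk2, hω⟩ := hω
    simp only [Set.mem_iUnion, Finset.mem_range, Finset.mem_Icc, Set.mem_union, Set.mem_ofPred_eq]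
    refine ⟨j, by omega, k, ⟨hk1, hk2⟩, ?_⟩
    rw [not_and_or, not_le, not_le] at hω
    exact hω.imp (fun h => ⟨K, hK, h⟩) (fun h => ⟨K, hK, h⟩)
  have hterm : ∀ j, ∀ k ∈ Finset.Icc 1 n, P.real
        ({ω | ∃ K ∈ dyadicCubes d j,
            cellIntegral μ n (fun i => X i ω) s K / k + k * (4 * Real.log n)
            < cellCount n (fun i => X i ω) K - cellIntegral μ n (fun i => X i ω) s K} ∪
          {ω | ∃ K ∈ dyadicCubes d j,
            cellIntegral μ n (fun i => X i ω) s K / k + k * (4 * Real.log n)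
            < cellIntegral μ n (fun i => X i ω) s K - cellCount n (fun i => X i ω) K})
      ≤ 4 * n / ((n : ℝ) ^ 4 - 1) := by
    intro j k hk
    have hk1 := (Finset.mem_Icc.mp hk).1
    refine (measureReal_union_le _ _).trans ((add_le_add
      (h.measureReal_upper_le n j hk1 (t := 4 * Real.log n) (by positivity))
      (h.measureReal_lower_le n j hk1 (t := 4 * Real.log n) (by positivity))).trans ?_)
    rw [hexp, ← add_div]
    apply le_of_eq
    congr 1
    ring
  -- There are 2n + 1 levels and n scales, each failing with probability at most 4n/(n⁴ - 1); the
  -- exponent 4 in t = 4 log n leaves a factor 1/n.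
  calc P.real {ω | ¬ IsGoodPath μ s n fun i => X i ω}
      ≤ ∑ j ∈ Finset.range (2 * n + 1), ∑ k ∈ Finset.Icc 1 n, 4 * n / ((n : ℝ) ^ 4 - 1) := by
        refine (measureReal_mono hsub (measure_ne_top _ _)).trans
          ((measureReal_biUnion_finset_le _ _).trans ?_)
        refine Finset.sum_le_sum fun j _ => (measureReal_biUnion_finset_le _ _).trans ?_
        exact Finset.sum_le_sum fun k hk => hterm j k hk
    _ = (2 * n + 1) * (n * (4 * n / ((n : ℝ) ^ 4 - 1))) := by
        simp only [Finset.sum_const, Finset.card_range, Nat.card_Icc, nsmul_eq_mul]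
        push_cast
        simp
    _ ≤ (3 * n) * (n * (4 * n / ((n : ℝ) ^ 4 / 2))) := by
        have h1 : (1 : ℝ) ≤ (n : ℝ) ^ 4 / 2 := by
          have : (4 : ℝ) ^ 4 ≤ (n : ℝ) ^ 4 := by gcongr
          linarith
        have h2 : 4 * (n : ℝ) / ((n : ℝ) ^ 4 - 1) ≤ 4 * n / ((n : ℝ) ^ 4 / 2) := by
          gcongr
          linarith
        have h3 : 0 ≤ 4 * (n : ℝ) / ((n : ℝ) ^ 4 - 1) := div_nonneg (by positivity) (by linarith)
        exact mul_le_mul (by linarith) (by gcongr) (by positivity) (by positivity)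
    _ = 24 / n := by
        field_simp
        norm_num

/-! ### The selection rule -/

/-- `n` times the sum over `K' ∈ m'` of `α H² + T` on `K ∩ K'`, for the histogram estimators that
take the constant values attached to `K` and to the elements of `m'`. -/
def cellScore (μ : Measure (Fin d → ℝ)) (n : ℕ) (x : ℕ → Fin d → ℝ) (K : Set (Pair d))
    (m' : Finset (Set (Pair d))) : ℝ :=
  ∑ K' ∈ m', (alpha / 2 * (cellIntegral μ n x (fun _ => 1) (K ∩ K')
      * (Real.sqrt (cellRatio μ n x K) - Real.sqrt (cellRatio μ n x K')) ^ 2)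
    + cellTest (cellIntegral μ n x (fun _ => 1) (K ∩ K')) (cellCount n x (K ∩ K'))
      (cellRatio μ n x K) (cellRatio μ n x K'))

section Path

variable {μ : Measure (Fin d → ℝ)} {n : ℕ} {x : ℕ → Fin d → ℝ}
  {m m' : Finset (Set (Pair d))} {L : ℝ} {ℓ : ℕ∞}

lemma alpha_nonneg : 0 ≤ alpha := by
  unfold alpha; linarith [one_div_sqrt_two_le_one]

lemma sum_eq_cellScore (hm : IsDyadicPartition m) (hm' : IsDyadicPartition m')
    {K : Set (Pair d)} (hK : K ∈ m) :
    ∑ K' ∈ m', (alpha * hellingerSq μ n x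
            ((K ∩ K').indicator (histogramEstimator μ n x m))
            ((K ∩ K').indicator (histogramEstimator μ n x m'))
          + testT μ n x
            ((K ∩ K').indicator (histogramEstimator μ n x m))
            ((K ∩ K').indicator (histogramEstimator μ n x m')))
      = 1 / (n : ℝ) * cellScore μ n x K m' := by
  unfold cellScore
  rw [Finset.mul_sum]
  refine Finset.sum_congr rfl fun K' hK' => ?_
  have hJ : K ∩ K' ⊆ unitSquare d := Set.inter_subset_left.trans (hm.subset hK)
  rw [hellingerSq_indicator hJ (fun p hp => histogramEstimator_eq hm hK hp.1)
      (fun p hp => histogramEstimator_eq hm' hK' hp.2),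
    testT_indicator hJ (fun p hp => histogramEstimator_eq hm hK hp.1)
      (fun p hp => histogramEstimator_eq hm' hK' hp.2)]
  ring

lemma criterion_eq (hm : IsDyadicPartition m) :
    criterion μ n L ℓ x m = (∑ K ∈ m, ⨆ m' : partitions d ℓ,
      (1 / (n : ℝ) * cellScore μ n x K m'.1 - pen L n (join m'.1 K))) + 2 * pen L n m := by
  unfold criterion
  congr 1
  refine Finset.sum_congr rfl fun K hK => ?_
  congr 1
  ext m'
  rw [sum_eq_cellScore hm (.of_mem_partitions m'.2) hK]

lemma pen_nonneg (hL : 0 ≤ L) (m : Finset (Set (Pair d))) : 0 ≤ pen L n m := by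
  unfold pen
  have := Real.log_natCast_nonneg n
  positivity

lemma sum_pen_join_le (hL : 0 ≤ L) {c : ℕ} (hc : ∑ K ∈ m, (join m' K).card ≤ c) :
    ∑ K ∈ m, pen L n (join m' K) ≤ L * (c * Real.log n / n) := by
  unfold pen
  have := Real.log_natCast_nonneg n
  have hc' : ∑ K ∈ m, ((join m' K).card : ℝ) ≤ c := by exact_mod_cast hc
  rw [← Finset.mul_sum, ← Finset.sum_div, ← Finset.sum_mul]
  gcongr

/-- The antisymmetry of the test. -/
lemma neg_sum_cellScore_le (m m' : Finset (Set (Pair d))) :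
    -∑ K' ∈ m', cellScore μ n x K' m ≤ ∑ K ∈ m, cellScore μ n x K m' := by
  rw [neg_le_iff_add_nonneg]
  unfold cellScore
  rw [Finset.sum_comm (s := m'), ← Finset.sum_add_distrib]
  refine Finset.sum_nonneg fun K _ => ?_
  rw [← Finset.sum_add_distrib]
  refine Finset.sum_nonneg fun K' _ => ?_
  rw [Set.inter_comm K' K, cellTest_neg _ _ (cellRatio μ n x K) (cellRatio μ n x K')]
  have hD : 0 ≤ cellIntegral μ n x (fun _ => 1) (K ∩ K') :=
    cellIntegral_nonneg fun _ => zero_le_one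
  have hα := alpha_nonneg
  have h1 : 0 ≤ alpha / 2 * (cellIntegral μ n x (fun _ => 1) (K ∩ K')
      * (Real.sqrt (cellRatio μ n x K) - Real.sqrt (cellRatio μ n x K')) ^ 2) := by positivity
  have h2 : 0 ≤ alpha / 2 * (cellIntegral μ n x (fun _ => 1) (K ∩ K')
      * (Real.sqrt (cellRatio μ n x K') - Real.sqrt (cellRatio μ n x K)) ^ 2) := by positivity
  linarith

/-- The intersection is K or K'. The level of K is at most |m| ≤ n, and that of K' exceeds it by at
most the number of pieces of m' in K, hence is at most 2n: this is the depth built into the good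
event. -/
lemma IsGoodPath.isConcentrated_inter {s : Pair d → ℝ} (hd : 0 < d)
    (hgood : IsGoodPath μ s n x)
    (hm : IsDyadicPartition m) (hm' : IsDyadicPartition m') (hmn : m.card ≤ n)
    {K K' : Set (Pair d)} (hK : K ∈ m) (hK' : K' ∈ m') (hcard : (join m' K).card ≤ n)
    (hne : (K ∩ K').Nonempty) :
    IsConcentrated n (cellCount n x (K ∩ K')) (cellIntegral μ n x s (K ∩ K')) := by
  obtain ⟨a, ha⟩ := hm.exists_level K hK
  obtain ⟨b, hb⟩ := hm'.exists_level K' hK'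
  have han := hm.level_le_card hd hK ha
  have hbn := hm'.le_add_card_join hd ha hK' hb hne
  rcases hm.exists_level_inter hm' hK hK' hne with h | h <;> rw [h]
  · exact hgood a (by omega) K ha
  · exact hgood b (by omega) K' hb

variable [IsFiniteMeasure (μ.restrict (unitCube d))]

lemma cellIntegral_one_mono {J K : Set (Pair d)} (hJ : MeasurableSet J) (hK : MeasurableSet K)
    (h : J ⊆ K) : cellIntegral μ n x (fun _ => 1) J ≤ cellIntegral μ n x (fun _ => 1) K := by
  refine Finset.sum_le_sum fun i _ => integral_mono
    (integrable_indicator_section measurable_const (fun _ => integrable_const _) hJ (x i))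
    (integrable_indicator_section measurable_const (fun _ => integrable_const _) hK (x i))
    fun y => ?_
  exact Set.indicator_le_indicator_of_subset h (fun _ => zero_le_one) _

/-- A bound for the score that holds on any path. -/
lemma cellScore_le (hm : IsDyadicPartition m) (hm' : IsDyadicPartition m') {K : Set (Pair d)}
    (hK : K ∈ m) : cellScore μ n x K m' ≤ 4 * n := by
  have hKA := hm.subset hK
  have hKm := hm.measurableSet hK
  have hr : ∀ J, 0 ≤ cellRatio μ n x J := fun J => cellRatio_nonneg
  calc cellScore μ n x K m'
      ≤ ∑ K' ∈ m', (cellCount n x (K ∩ K')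
          + 2 * (cellIntegral μ n x (fun _ => 1) (K ∩ K') * cellRatio μ n x K)
          + cellIntegral μ n x (fun _ => 1) K' * cellRatio μ n x K') := by
        refine Finset.sum_le_sum fun K' hK' => ?_
        refine (cellTest_le_of_nonneg (cellIntegral_nonneg fun _ => zero_le_one)
          cellCount_nonneg (hr K) (hr K')).trans ?_
        have := cellIntegral_one_mono (μ := μ) (n := n) (x := x)
          (hKm.inter (hm'.measurableSet hK')) (hm'.measurableSet hK')
          (Set.inter_subset_right (s := K))
        have := mul_le_mul_of_nonneg_right this (hr K')
        linarith
    _ = cellCount n x K + 2 * (cellIntegral μ n x (fun _ => 1) K * cellRatio μ n x K)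
          + ∑ K' ∈ m', cellIntegral μ n x (fun _ => 1) K' * cellRatio μ n x K' := by
        rw [Finset.sum_add_distrib, Finset.sum_add_distrib, ← Finset.mul_sum, ← Finset.sum_mul,
          hm'.sum_cellCount_inter hKA,
          hm'.sum_cellIntegral_inter hKA hKm measurable_const (fun _ => integrable_const _)]
    _ ≤ n + 2 * n + n := by
        have h1 : ∑ K' ∈ m', cellIntegral μ n x (fun _ => 1) K' * cellRatio μ n x K' ≤ n :=
          (Finset.sum_le_sum fun K' _ => cellIntegral_mul_cellRatio_le).trans
            (hm'.sum_cellCount_le n x)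
        have h2 := cellIntegral_mul_cellRatio_le (μ := μ) (n := n) (x := x) (K := K)
        have h3 : cellCount n x K ≤ n := cellCount_le
        linarith
    _ = 4 * n := by ring

lemma score_sub_pen_le (hn : 0 < n) (hL : 0 ≤ L) (hm : IsDyadicPartition m)
    {K : Set (Pair d)} (hK : K ∈ m) (m' : partitions d ℓ) :
    1 / (n : ℝ) * cellScore μ n x K m'.1 - pen L n (join m'.1 K) ≤ 4 := by
  have h1 := cellScore_le (μ := μ) (n := n) (x := x) hm (.of_mem_partitions m'.2) hK
  have h2 := pen_nonneg (n := n) hL (join m'.1 K)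
  have hn' : (0 : ℝ) < n := by exact_mod_cast hn
  have h3 : 1 / (n : ℝ) * cellScore μ n x K m'.1 ≤ 4 := by
    rw [one_div_mul_eq_div, div_le_iff₀ hn']; exact h1
  linarith

lemma bddAbove_score (hn : 0 < n) (hL : 0 ≤ L) (hm : IsDyadicPartition m)
    {K : Set (Pair d)} (hK : K ∈ m) :
    BddAbove (Set.range fun m' : partitions d ℓ =>
      1 / (n : ℝ) * cellScore μ n x K m'.1 - pen L n (join m'.1 K)) :=
  ⟨4, by rintro _ ⟨m', rfl⟩; exact score_sub_pen_le hn hL hm hK m'⟩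

/-- Choose m' in every supremum, then use antisymmetry to exchange the roles of m and m'. Applied to
the selected partition, this brings in the test of a fixed m against it. -/
lemma criterion_ge (hn : 0 < n) (hL : 0 ≤ L) (hm : m ∈ partitions d ℓ)
    (hm' : m' ∈ partitions d ℓ) {c : ℕ} (hc : ∑ K ∈ m, (join m' K).card ≤ c) :
    -(1 / (n : ℝ) * ∑ K' ∈ m', cellScore μ n x K' m) - L * (c * Real.log n / n) + 2 * pen L n m
      ≤ criterion μ n L ℓ x m := by
  have hP := IsDyadicPartition.of_mem_partitions hm
  rw [criterion_eq hP]
  have h1 : ∑ K ∈ m, (1 / (n : ℝ) * cellScore μ n x K m' - pen L n (join m' K))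
      ≤ ∑ K ∈ m, ⨆ m' : partitions d ℓ,
        (1 / (n : ℝ) * cellScore μ n x K m'.1 - pen L n (join m'.1 K)) :=
    Finset.sum_le_sum fun K hK => le_ciSup (bddAbove_score hn hL hP hK) ⟨m', hm'⟩
  rw [Finset.sum_sub_distrib, ← Finset.mul_sum] at h1
  have h2 := sum_pen_join_le (n := n) hL hc
  have h3 := mul_le_mul_of_nonneg_left (neg_sum_cellScore_le (μ := μ) (n := n) (x := x) m m')
    (show (0 : ℝ) ≤ 1 / n by positivity)
  linarith

/-- Testing m against itself has a nonnegative total score by antisymmetry, and the joins cost at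
most one of the two penalties. This bounds the criterion below and the size of the selected
partition above. -/
lemma pen_le_criterion (hn : 0 < n) (hL : 0 ≤ L) (hm : m ∈ partitions d ℓ) :
    pen L n m ≤ criterion μ n L ℓ x m := by
  classical
  have hP := IsDyadicPartition.of_mem_partitions hm
  have hself : ∑ K ∈ m, (join m K).card ≤ m.card := by
    simpa using hP.sum_card_join_le hP
  rw [criterion_eq hP]
  have h1 : ∑ K ∈ m, (1 / (n : ℝ) * cellScore μ n x K m - pen L n (join m K))
      ≤ ∑ K ∈ m, ⨆ m' : partitions d ℓ,
        (1 / (n : ℝ) * cellScore μ n x K m'.1 - pen L n (join m'.1 K)) :=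
    Finset.sum_le_sum fun K hK => le_ciSup (bddAbove_score hn hL hP hK) ⟨m, hm⟩
  rw [Finset.sum_sub_distrib, ← Finset.mul_sum] at h1
  have h2 := sum_pen_join_le (n := n) hL hself
  have h3 : 0 ≤ ∑ K ∈ m, cellScore μ n x K m := by
    have := neg_sum_cellScore_le (μ := μ) (n := n) (x := x) m m
    linarith
  have h4 : 0 ≤ 1 / (n : ℝ) * ∑ K ∈ m, cellScore μ n x K m := by positivity
  change _ ≤ pen L n m at h2
  linarith

/-- A selected partition has at most `n` elements. -/
lemma card_le_of_criterion_le (hn : 3 < n) (hlog : 1 ≤ Real.log n) (hL : 10 ≤ L)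
    (hm : m ∈ partitions d ℓ)
    (hsel : criterion μ n L ℓ x m
      ≤ (⨅ m' : partitions d ℓ, criterion μ n L ℓ x m'.1) + 1 / (n : ℝ)) : m.card ≤ n := by
  have hn0 : 0 < n := by omega
  have hn' : (4 : ℝ) ≤ n := by exact_mod_cast hn
  have hL0 : 0 ≤ L := by linarith
  have hA := singleton_mem_partitions d ℓ
  have h1 : criterion μ n L ℓ x {unitSquare d} ≤ 4 + 2 * pen L n ({unitSquare d}) := by
    rw [criterion_eq IsDyadicPartition.singleton, Finset.sum_singleton]
    have : Nonempty (partitions d ℓ) := ⟨⟨_, hA⟩⟩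
    gcongr
    exact ciSup_le fun m' => score_sub_pen_le hn0 hL0 IsDyadicPartition.singleton
      (Finset.mem_singleton_self _) m'
  have h2 : (⨅ m' : partitions d ℓ, criterion μ n L ℓ x m'.1)
      ≤ criterion μ n L ℓ x {unitSquare d} :=
    ciInf_le (f := fun m' : partitions d ℓ => criterion μ n L ℓ x m'.1)
      ⟨0, by rintro _ ⟨m', rfl⟩; exact (pen_nonneg hL0 _).trans (pen_le_criterion hn0 hL0 m'.2)⟩
      ⟨_, hA⟩
  have h3 := pen_le_criterion (μ := μ) (x := x) hn0 hL0 hm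
  have h4 : 1 / (n : ℝ) ≤ 1 := by rw [div_le_one (by linarith)]; linarith
  have h5 : pen L n m ≤ 5 + 2 * pen L n ({unitSquare d}) := by linarith
  unfold pen at h5
  rw [Finset.card_singleton] at h5
  have h6 : L * ((m.card : ℝ) * Real.log n) ≤ 5 * n + 2 * (L * Real.log n) := by
    have := mul_le_mul_of_nonneg_right h5 (show (0 : ℝ) ≤ n by linarith)
    have e1 : L * ((m.card : ℝ) * Real.log n / n) * n = L * ((m.card : ℝ) * Real.log n) := by
      field_simp
    have e2 : (5 + 2 * (L * (((1 : ℕ) : ℝ) * Real.log n / n))) * n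
        = 5 * n + 2 * (L * Real.log n) := by
      field_simp
      push_cast
      ring
    linarith
  -- As L log n ≥ 10, the comparison with the trivial partition gives |m| ≤ 2 + n/2, which is at
  -- most n for n ≥ 4.
  have h7 : L * Real.log n * ((m.card : ℝ) - 2 - n / 2) ≤ 0 := by
    have : 10 * 1 ≤ L * Real.log n := mul_le_mul hL hlog zero_le_one hL0
    nlinarith
  have h8 : 0 < L * Real.log n := by positivity
  have h9 : (m.card : ℝ) - 2 - n / 2 ≤ 0 := by
    by_contra hcon
    have := mul_pos h8 (not_le.mp hcon)
    linarith
  have h10 : (m.card : ℝ) ≤ n := by linarith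
  exact_mod_cast h10

variable {s : Pair d → ℝ}

/-- The score on cells where the observations are concentrated. -/
lemma cellScore_le_of_isConcentrated (hs : IsSubdensity μ s) (hlog : 1 ≤ Real.log n)
    (hm' : IsDyadicPartition m') {K : Set (Pair d)} (hKA : K ⊆ unitSquare d)
    (hKm : MeasurableSet K)
    (hC : ∀ K' ∈ m', (K ∩ K').Nonempty →
      IsConcentrated n (cellCount n x (K ∩ K')) (cellIntegral μ n x s (K ∩ K'))) :
    cellScore μ n x K m' ≤ 2 * cellLoss (cellIntegral μ n x (fun _ => 1) K)
        (cellIntegral μ n x (fun p => Real.sqrt (s p)) K) (cellIntegral μ n x s K)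
        (cellRatio μ n x K)
      - 1 / 60 * ∑ K' ∈ m', cellLoss (cellIntegral μ n x (fun _ => 1) (K ∩ K'))
        (cellIntegral μ n x (fun p => Real.sqrt (s p)) (K ∩ K')) (cellIntegral μ n x s (K ∩ K'))
        (cellRatio μ n x K')
      + 804 * Real.log n * (join m' K).card := by
  classical
  rw [hm'.card_join, Finset.card_filter, ← hm'.sum_cellLoss_inter hs hKA hKm]
  push_cast
  rw [Finset.mul_sum, Finset.mul_sum, Finset.mul_sum, ← Finset.sum_sub_distrib,
    ← Finset.sum_add_distrib]
  refine Finset.sum_le_sum fun K' hK' => ?_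
  by_cases hne : (K ∩ K').Nonempty
  · rw [if_pos hne, mul_one]
    have hJm := hKm.inter (hm'.measurableSet hK')
    exact cellTest_le (hs.isMomentTriple hJm) (hC K' hK' hne) hlog cellCount_nonneg cellCount_le
      (hs.cellIntegral_le hJm) cellRatio_nonneg cellRatio_nonneg
  · rw [if_neg hne, Set.not_nonempty_iff_eq_empty.mp hne]
    simp [cellTest, cellLoss, cellCount, cellIntegral]

/-- The upper bound for the criterion on good paths. -/
lemma IsGoodPath.criterion_le (hd : 0 < d) (hn : 0 < n) (hlog : 1 ≤ Real.log n)
    (hs : IsSubdensity μ s) (hgood : IsGoodPath μ s n x) (hL : 804 ≤ L)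
    (hm : IsDyadicPartition m) (hmn : m.card ≤ n) :
    criterion μ n L ℓ x m ≤ 1 / (n : ℝ) * (2 * estimatorLoss μ s n x m) + 2 * pen L n m := by
  have hn' : (0 : ℝ) < n := by exact_mod_cast hn
  rw [criterion_eq hm]
  gcongr
  unfold estimatorLoss
  rw [Finset.mul_sum, Finset.mul_sum]
  refine Finset.sum_le_sum fun K hK => ?_
  have : Nonempty (partitions d ℓ) := ⟨⟨_, singleton_mem_partitions d ℓ⟩⟩
  refine ciSup_le fun m' => ?_
  have hm' := IsDyadicPartition.of_mem_partitions m'.2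
  have hloss := (hs.isMomentTriple (n := n) (x := x) (hm.measurableSet hK)).cellLoss_nonneg
    (cellRatio_nonneg (μ := μ) (n := n) (x := x) (K := K))
  -- With at most n pieces in K, concentration applies and the penalty covers the noise. With more,
  -- the penalty alone is at least 804 while the normalised score never exceeds 4.
  rcases le_or_gt (join m'.1 K).card n with hcard | hcard
  · have h1 := cellScore_le_of_isConcentrated (n := n) (x := x) hs hlog hm' (hm.subset hK)
      (hm.measurableSet hK)
      fun K' hK' hne => hgood.isConcentrated_inter hd hm hm' hmn hK hK' hcard hne
    have h2 : 0 ≤ ∑ K' ∈ m'.1, cellLoss (cellIntegral μ n x (fun _ => 1) (K ∩ K'))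
        (cellIntegral μ n x (fun p => Real.sqrt (s p)) (K ∩ K')) (cellIntegral μ n x s (K ∩ K'))
        (cellRatio μ n x K') := Finset.sum_nonneg fun K' hK' =>
      (hs.isMomentTriple ((hm.measurableSet hK).inter (hm'.measurableSet hK'))).cellLoss_nonneg
        cellRatio_nonneg
    have h3 : pen L n (join m'.1 K) = 1 / (n : ℝ) * (L * Real.log n * (join m'.1 K).card) := by
      unfold pen; ring
    have h4 : 804 * Real.log n * (join m'.1 K).card ≤ L * Real.log n * (join m'.1 K).card := by
      gcongr
    rw [h3, ← mul_sub]
    gcongr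
    linarith
  · have h1 := cellScore_le (μ := μ) (n := n) (x := x) hm hm' hK
    have h2 : 804 ≤ pen L n (join m'.1 K) := by
      unfold pen
      have hc : (n : ℝ) ≤ (join m'.1 K).card := by exact_mod_cast hcard.le
      have : (1 : ℝ) ≤ ((join m'.1 K).card : ℝ) * Real.log n / n := by
        rw [le_div_iff₀ hn', one_mul]
        nlinarith
      nlinarith
    have h3 : 1 / (n : ℝ) * cellScore μ n x K m'.1 ≤ 4 := by
      rw [one_div_mul_eq_div, div_le_iff₀ hn']; exact h1
    have h4 : 0 ≤ 1 / (n : ℝ) * (2 * cellLoss (cellIntegral μ n x (fun _ => 1) K)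
        (cellIntegral μ n x (fun p => Real.sqrt (s p)) K) (cellIntegral μ n x s K)
        (cellRatio μ n x K)) := by positivity
    linarith

/-- The cellwise near-optimality of N/D is applied against the best constant on each cell. The
factor 8n is 4 times the normalisation 2n of the loss. -/
lemma IsGoodPath.estimatorLoss_le (hd : 0 < d) (hn : 0 < n) (hlog : 1 ≤ Real.log n)
    (hs : IsSubdensity μ s) (hgood : IsGoodPath μ s n x) (hm : IsDyadicPartition m)
    (hmn : m.card ≤ n) :
    estimatorLoss μ s n x m
      ≤ 8 * n * hellingerSqDist μ n x ((unitSquare d).indicator s) (histograms m)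
        + 1618 * (m.card * Real.log n) := by
  have hn' : (0 : ℝ) < n := by exact_mod_cast hn
  rw [hellingerSqDist_histograms hs hm]
  have h1 : estimatorLoss μ s n x m ≤ ∑ K ∈ m, (4 * cellLoss (cellIntegral μ n x (fun _ => 1) K)
        (cellIntegral μ n x (fun p => Real.sqrt (s p)) K) (cellIntegral μ n x s K)
        ((cellIntegral μ n x (fun p => Real.sqrt (s p)) K
          / cellIntegral μ n x (fun _ => 1) K) ^ 2) + 1618 * Real.log n) := by
    refine Finset.sum_le_sum fun K hK => ?_
    obtain ⟨a, ha⟩ := hm.exists_level K hK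
    have han := hm.level_le_card hd hK ha
    exact cellLoss_estimator_le (hs.isMomentTriple (hm.measurableSet hK))
      (hgood a (by omega) K ha) hlog cellCount_nonneg cellCount_le
      (hs.cellIntegral_le (hm.measurableSet hK)) (sq_nonneg _)
  refine h1.trans (le_of_eq ?_)
  rw [Finset.sum_add_distrib, ← Finset.mul_sum, Finset.sum_const, nsmul_eq_mul]
  field_simp
  ring

/-- The oracle inequality on good paths. -/
lemma IsGoodPath.hellingerSq_le {mhat : Finset (Set (Pair d))} (hd : 0 < d) (hn : 3 < n)
    (hlog : 1 ≤ Real.log n) (hs : IsSubdensity μ s) (hgood : IsGoodPath μ s n x) (hL : 1000 ≤ L)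
    (hm : m ∈ partitions d ℓ) (hmn : m.card ≤ n) (hmhat : mhat ∈ partitions d ℓ)
    (hsel : criterion μ n L ℓ x mhat
      ≤ (⨅ m' : partitions d ℓ, criterion μ n L ℓ x m'.1) + 1 / (n : ℝ)) :
    hellingerSq μ n x ((unitSquare d).indicator s) (histogramEstimator μ n x mhat)
      ≤ 960 * (hellingerSqDist μ n x ((unitSquare d).indicator s) (histograms m)
        + pen L n m) := by
  classical
  have hn0 : 0 < n := by omega
  have hn' : (0 : ℝ) < n := by exact_mod_cast hn0
  have hL0 : 0 ≤ L := by linarith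
  have hP := IsDyadicPartition.of_mem_partitions hm
  have hP' := IsDyadicPartition.of_mem_partitions hmhat
  have hmhatn := card_le_of_criterion_le hn hlog (by linarith) hmhat hsel
  have hinf : (⨅ m' : partitions d ℓ, criterion μ n L ℓ x m'.1) ≤ criterion μ n L ℓ x m :=
    ciInf_le (f := fun m' : partitions d ℓ => criterion μ n L ℓ x m'.1)
      ⟨0, by rintro _ ⟨m', rfl⟩; exact (pen_nonneg hL0 _).trans (pen_le_criterion hn0 hL0 m'.2)⟩
      ⟨_, hm⟩
  have hup := hgood.criterion_le (ℓ := ℓ) (L := L) hd hn0 hlog hs (by linarith) hP hmn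
  have hlow := criterion_ge (μ := μ) (x := x) hn0 hL0 hmhat hm
    ((hP'.sum_card_join_le hP).trans (Finset.card_union_le _ _))
  have hjoin : ∑ K ∈ m, ((join mhat K).card : ℝ) ≤ mhat.card + m.card := by
    have := (hP.sum_card_join_le hP').trans (Finset.card_union_le _ _)
    rw [add_comm] at this
    exact_mod_cast this
  have hscore : ∑ K ∈ m, cellScore μ n x K mhat
      ≤ 2 * estimatorLoss μ s n x m - 1 / 60 * estimatorLoss μ s n x mhat
        + 804 * Real.log n * (mhat.card + m.card) := by
    calc ∑ K ∈ m, cellScore μ n x K mhat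
        ≤ ∑ K ∈ m, (2 * cellLoss (cellIntegral μ n x (fun _ => 1) K)
              (cellIntegral μ n x (fun p => Real.sqrt (s p)) K) (cellIntegral μ n x s K)
              (cellRatio μ n x K)
            - 1 / 60 * ∑ K' ∈ mhat, cellLoss (cellIntegral μ n x (fun _ => 1) (K ∩ K'))
              (cellIntegral μ n x (fun p => Real.sqrt (s p)) (K ∩ K'))
              (cellIntegral μ n x s (K ∩ K')) (cellRatio μ n x K')
            + 804 * Real.log n * (join mhat K).card) := by
          refine Finset.sum_le_sum fun K hK => ?_
          refine cellScore_le_of_isConcentrated hs hlog hP' (hP.subset hK) (hP.measurableSet hK)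
            fun K' hK' hne => ?_
          refine hgood.isConcentrated_inter hd hP hP' hmn hK hK' ?_ hne
          rw [hP'.card_join]
          exact (Finset.card_filter_le _ _).trans hmhatn
      _ = 2 * estimatorLoss μ s n x m - 1 / 60 * estimatorLoss μ s n x mhat
            + 804 * Real.log n * ∑ K ∈ m, ((join mhat K).card : ℝ) := by
          rw [Finset.sum_add_distrib, Finset.sum_sub_distrib, ← Finset.mul_sum, ← Finset.mul_sum,
            ← Finset.mul_sum, Finset.sum_comm]
          have : estimatorLoss μ s n x mhat = ∑ K' ∈ mhat, ∑ K ∈ m,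
              cellLoss (cellIntegral μ n x (fun _ => 1) (K ∩ K'))
              (cellIntegral μ n x (fun p => Real.sqrt (s p)) (K ∩ K'))
              (cellIntegral μ n x s (K ∩ K')) (cellRatio μ n x K') := by
            refine Finset.sum_congr rfl fun K' hK' => ?_
            rw [← hP.sum_cellLoss_inter hs (hP'.subset hK') (hP'.measurableSet hK')]
            simp_rw [Set.inter_comm K']
          rw [this]
          rfl
      _ ≤ _ := by gcongr
  have hest := hgood.estimatorLoss_le hd hn0 hlog hs hP hmn
  rw [hellingerSq_histogramEstimator hs hP']
  set H := hellingerSqDist μ n x ((unitSquare d).indicator s) (histograms m)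
  set E := estimatorLoss μ s n x m
  set E' := estimatorLoss μ s n x mhat
  have hH0 : 0 ≤ H := hellingerSqDist_nonneg hs hP
  -- Sandwich of the criterion at the selected partition: the antisymmetry lower bound with the
  -- score estimate on the left, near-minimality and the upper bound at m on the right.
  have key : -(1 / (n : ℝ) * (2 * E - 1 / 60 * E' + 804 * Real.log n * (mhat.card + m.card)))
      - L * ((mhat.card + m.card) * Real.log n / n) + 2 * pen L n mhat
      ≤ 1 / (n : ℝ) * (2 * E) + 2 * pen L n m + 1 / (n : ℝ) := by
    have h1 := mul_le_mul_of_nonneg_left hscore (show (0 : ℝ) ≤ 1 / n by positivity)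
    push_cast at hlow
    linarith
  unfold pen at key ⊢
  have key' : E' ≤ 60 * (4 * E + 1 + 804 * Real.log n * (mhat.card + m.card)
      + L * ((mhat.card + m.card) * Real.log n) - 2 * (L * (mhat.card * Real.log n))
      + 2 * (L * (m.card * Real.log n))) := by
    have h1 := mul_le_mul_of_nonneg_left key hn'.le
    have e1 : (n : ℝ) * (-(1 / (n : ℝ) * (2 * E - 1 / 60 * E'
        + 804 * Real.log n * (mhat.card + m.card)))
        - L * ((mhat.card + m.card) * Real.log n / n) + 2 * (L * (mhat.card * Real.log n / n)))
        = -(2 * E - 1 / 60 * E' + 804 * Real.log n * (mhat.card + m.card))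
        - L * ((mhat.card + m.card) * Real.log n) + 2 * (L * (mhat.card * Real.log n)) := by
      field_simp
    have e2 : (n : ℝ) * (1 / (n : ℝ) * (2 * E) + 2 * (L * (m.card * Real.log n / n))
        + 1 / (n : ℝ)) = 2 * E + 2 * (L * (m.card * Real.log n)) + 1 := by
      field_simp
    rw [e1, e2] at h1
    linarith
  have hcard : (1 : ℝ) ≤ m.card := by exact_mod_cast hP.card_pos
  have hu : (1 : ℝ) ≤ m.card * Real.log n := by nlinarith
  have hv : (0 : ℝ) ≤ mhat.card * Real.log n := by positivity
  have hLu : 1000 * (m.card * Real.log n) ≤ L * (m.card * Real.log n) := by gcongr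
  have hLv : 1000 * (mhat.card * Real.log n) ≤ L * (mhat.card * Real.log n) := by gcongr
  -- The terms in the selected cardinality have total coefficient 804 + L - 2L ≤ 0 and drop out.
  -- Those in |m| amount to 3L + 804 + 4 · 1618 + 1, at most 14L since L ≥ 1000.
  have hfin : E' ≤ 60 * (32 * n * H + 14 * (L * (m.card * Real.log n))) := by linarith
  calc 1 / (2 * (n : ℝ)) * E'
      ≤ 1 / (2 * (n : ℝ)) * (60 * (32 * n * H + 14 * (L * (m.card * Real.log n)))) := by gcongr
    _ = 960 * H + 420 * (L * (m.card * Real.log n / n)) := by field_simp; ring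
    _ ≤ 960 * (H + L * (m.card * Real.log n / n)) := by
        have : 0 ≤ L * (m.card * Real.log n / n) := by positivity
        linarith

lemma hellingerSq_histogramEstimator_nonneg (hs : IsSubdensity μ s) (hm : IsDyadicPartition m) :
    0 ≤ hellingerSq μ n x ((unitSquare d).indicator s) (histogramEstimator μ n x m) := by
  rw [hellingerSq_histogramEstimator hs hm]
  exact mul_nonneg (by positivity) (estimatorLoss_nonneg hs hm)

lemma hellingerSq_histogramEstimator_le_one (hs : IsSubdensity μ s) (hm : IsDyadicPartition m) :
    hellingerSq μ n x ((unitSquare d).indicator s) (histogramEstimator μ n x m) ≤ 1 := by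
  rw [hellingerSq_histogramEstimator hs hm]
  rcases Nat.eq_zero_or_pos n with h0 | h0
  · subst h0; simp
  · have hn' : (0 : ℝ) < n := by exact_mod_cast h0
    rw [one_div_mul_eq_div, div_le_one (by positivity)]
    exact TransitionDensity.estimatorLoss_le hs hm

end Path

/-! ### Integrability of the losses -/

section Integrability

variable {Ω : Type*} [MeasurableSpace Ω] {P : Measure Ω}
  {μ : Measure (Fin d → ℝ)} [IsFiniteMeasure (μ.restrict (unitCube d))] {s : Pair d → ℝ}
  {X : ℕ → Ω → Fin d → ℝ} {m : Finset (Set (Pair d))}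

lemma measurable_cellLoss {D R S a : Ω → ℝ} (hD : Measurable D) (hR : Measurable R)
    (hS : Measurable S) (ha : Measurable a) :
    Measurable fun ω => cellLoss (D ω) (R ω) (S ω) (a ω) :=
  (hS.sub ((ha.sqrt.const_mul 2).mul hR)).add (ha.mul hD)

lemma IsMarkovChain.measurable_hellingerSq (h : IsMarkovChain P μ s X) (n : ℕ)
    (hm : IsDyadicPartition m) :
    Measurable fun ω => hellingerSq μ n (fun i => X i ω) ((unitSquare d).indicator s)
      (histogramEstimator μ n (fun i => X i ω) m) := by
  have hs := h.isSubdensity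
  simp_rw [hellingerSq_histogramEstimator hs hm]
  refine Measurable.const_mul (Finset.measurable_sum _ fun K hK => ?_) _
  have hKm := hm.measurableSet hK
  have hX := h.measurable_chain
  have hD := measurable_cellIntegral (μ := μ) n (fun i _ => hX i)
    (measurable_const (a := (1 : ℝ))) hKm
  exact measurable_cellLoss hD (measurable_cellIntegral n (fun i _ => hX i) hs.measurable_sqrt hKm)
    (measurable_cellIntegral n (fun i _ => hX i) hs.measurable hKm)
    ((measurable_cellCount n (fun i _ => hX i) hKm).div hD)

variable [IsProbabilityMeasure P]

/-- The closed form of the infimum gives measurability, and its values lie in [0, 1/2]. -/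
lemma IsMarkovChain.integrable_hellingerSqDist (h : IsMarkovChain P μ s X) (n : ℕ)
    (hm : IsDyadicPartition m) :
    Integrable (fun ω => hellingerSqDist μ n (fun i => X i ω) ((unitSquare d).indicator s)
      (histograms m)) P := by
  have hs := h.isSubdensity
  refine Integrable.of_bound (C := 1 / 2) (Measurable.aestronglyMeasurable ?_)
    (Filter.Eventually.of_forall fun ω => by
      rw [Real.norm_of_nonneg (hellingerSqDist_nonneg hs hm)]
      exact hellingerSqDist_le hs hm)
  simp_rw [hellingerSqDist_histograms hs hm]
  refine Measurable.const_mul (Finset.measurable_sum _ fun K hK => ?_) _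
  have hKm := hm.measurableSet hK
  have hX := h.measurable_chain
  have hD := measurable_cellIntegral (μ := μ) n (fun i _ => hX i)
    (measurable_const (a := (1 : ℝ))) hKm
  have hR := measurable_cellIntegral (μ := μ) n (fun i _ => hX i) hs.measurable_sqrt hKm
  exact measurable_cellLoss hD hR (measurable_cellIntegral n (fun i _ => hX i) hs.measurable hKm)
    ((hR.div hD).pow_const 2)

/-- The loss lies in [0, 1]. It is measurable because the selected partition takes countably many
values, each on a measurable event where the loss is that of a fixed partition. -/
lemma IsSelected.integrable_hellingerSq {n : ℕ} {L : ℝ} {ℓ : ℕ∞}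
    {mhat : Ω → Finset (Set (Pair d))} (hsel : IsSelected μ n L ℓ X mhat)
    (h : IsMarkovChain P μ s X) :
    Integrable (fun ω => hellingerSq μ n (fun i => X i ω) ((unitSquare d).indicator s)
      (histogramEstimator μ n (fun i => X i ω) (mhat ω))) P := by
  have hs := h.isSubdensity
  refine Integrable.of_bound (C := 1) (Measurable.aestronglyMeasurable ?_)
    (Filter.Eventually.of_forall fun ω => by
      have hP := IsDyadicPartition.of_mem_partitions (hsel.mem ω)
      rw [Real.norm_of_nonneg (hellingerSq_histogramEstimator_nonneg hs hP)]
      exact hellingerSq_histogramEstimator_le_one hs hP)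
  intro B hB
  have hset : (fun ω => hellingerSq μ n (fun i => X i ω) ((unitSquare d).indicator s)
      (histogramEstimator μ n (fun i => X i ω) (mhat ω))) ⁻¹' B
      = ⋃ m ∈ partitions d ℓ, {ω | mhat ω = m} ∩
        (fun ω => hellingerSq μ n (fun i => X i ω) ((unitSquare d).indicator s)
          (histogramEstimator μ n (fun i => X i ω) m)) ⁻¹' B := by
    ext ω
    simp only [Set.mem_preimage, Set.mem_iUnion, Set.mem_inter_iff, Set.mem_ofPred_eq]
    constructor
    · exact fun hω => ⟨mhat ω, hsel.mem ω, rfl, hω⟩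
    · rintro ⟨m, -, rfl, hω⟩
      exact hω
  rw [hset]
  exact MeasurableSet.biUnion (countable_partitions d ℓ) fun m hm =>
    (hsel.measurableSet_eq m hm).inter
      (h.measurable_hellingerSq n (.of_mem_partitions hm) hB)

/-- The oracle inequality in expectation. -/
lemma IsSelected.integral_hellingerSq_le {n : ℕ} {L : ℝ} {ℓ : ℕ∞}
    {mhat : Ω → Finset (Set (Pair d))} (hsel : IsSelected μ n L ℓ X mhat)
    (h : IsMarkovChain P μ s X) (hd : 0 < d) (hn : 3 < n) (hL : 1000 ≤ L)
    (hm : m ∈ partitions d ℓ) :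
    ∫ ω, hellingerSq μ n (fun i => X i ω) ((unitSquare d).indicator s)
      (histogramEstimator μ n (fun i => X i ω) (mhat ω)) ∂P
      ≤ 961 * (∫ ω, hellingerSqDist μ n (fun i => X i ω) ((unitSquare d).indicator s)
        (histograms m) ∂P + pen L n m) := by
  have hs := h.isSubdensity
  have hP := IsDyadicPartition.of_mem_partitions hm
  have hn' : (4 : ℝ) ≤ n := by exact_mod_cast hn
  have hn0 : (0 : ℝ) < n := by linarith
  have hlog : 1 ≤ Real.log n := by
    rw [Real.le_log_iff_exp_le hn0]
    linarith [Real.exp_one_lt_d9]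
  have hcard : (1 : ℝ) ≤ m.card := by exact_mod_cast hP.card_pos
  have hdist : 0 ≤ ∫ ω, hellingerSqDist μ n (fun i => X i ω) ((unitSquare d).indicator s)
      (histograms m) ∂P := integral_nonneg fun ω => hellingerSqDist_nonneg hs hP
  -- If |m| > n the penalty exceeds 1, which already bounds the loss.
  rcases le_or_gt m.card n with hmn | hmn
  · have hpen : 24 / (n : ℝ) ≤ pen L n m := by
      unfold pen
      rw [← mul_div_assoc]
      gcongr
      nlinarith [mul_le_mul hcard hlog zero_le_one (by linarith)]
    set bad := {ω | ¬ IsGoodPath μ s n fun i => X i ω}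
    -- A measurable hull with the same probability replaces the bad event, so that its own
    -- measurability need not be examined.
    have hB := measurableSet_toMeasurable P bad
    have hdi := h.integrable_hellingerSqDist n hP
    calc ∫ ω, hellingerSq μ n (fun i => X i ω) ((unitSquare d).indicator s)
          (histogramEstimator μ n (fun i => X i ω) (mhat ω)) ∂P
        ≤ ∫ ω, (960 * (hellingerSqDist μ n (fun i => X i ω) ((unitSquare d).indicator s)
            (histograms m) + pen L n m)
            + (toMeasurable P bad).indicator (fun _ => (1 : ℝ)) ω) ∂P := by
          refine integral_mono (hsel.integrable_hellingerSq h)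
            (((hdi.fun_add (integrable_const _)).const_mul 960).add
              ((integrable_const (1 : ℝ)).indicator hB)) fun ω => ?_
          have hpen0 := pen_nonneg (n := n) (show 0 ≤ L by linarith) m
          have hd0 := hellingerSqDist_nonneg (n := n) (x := fun i => X i ω) hs hP
          by_cases hω : IsGoodPath μ s n fun i => X i ω
          · refine (hω.hellingerSq_le hd hn hlog hs hL hm hmn (hsel.mem ω)
              (hsel.criterion_le ω)).trans (le_add_of_nonneg_right ?_)
            exact Set.indicator_nonneg (fun _ _ => zero_le_one) _
          · have hmem : ω ∈ toMeasurable P bad := subset_toMeasurable P bad hω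
            simp only [Set.indicator_of_mem hmem]
            refine (hellingerSq_histogramEstimator_le_one hs
              (.of_mem_partitions (hsel.mem ω))).trans (le_add_of_nonneg_left (by positivity))
      _ = 960 * (∫ ω, hellingerSqDist μ n (fun i => X i ω) ((unitSquare d).indicator s)
            (histograms m) ∂P + pen L n m) + P.real bad := by
          rw [integral_add ((hdi.fun_add (integrable_const _)).const_mul 960)
              ((integrable_const (1 : ℝ)).indicator hB), integral_const_mul,
            integral_add hdi (integrable_const _), integral_indicator hB]
          simp [measureReal_def]
      _ ≤ _ := by
          have := h.measureReal_not_isGoodPath_le hn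
          linarith
  · have hpen : 1 ≤ pen L n m := by
      unfold pen
      have hc : (n : ℝ) ≤ m.card := by exact_mod_cast hmn.le
      have : (1 : ℝ) ≤ (m.card : ℝ) * Real.log n / n := by
        rw [le_div_iff₀ hn0, one_mul]
        nlinarith
      nlinarith
    calc ∫ ω, hellingerSq μ n (fun i => X i ω) ((unitSquare d).indicator s)
          (histogramEstimator μ n (fun i => X i ω) (mhat ω)) ∂P
        ≤ ∫ _, (1 : ℝ) ∂P := integral_mono (hsel.integrable_hellingerSq h) (integrable_const _)
          fun ω => hellingerSq_histogramEstimator_le_one hs (.of_mem_partitions (hsel.mem ω))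
      _ = 1 := by simp
      _ ≤ _ := by linarith

end Integrability

end TransitionDensity

end

/-! ### The oracle inequality with universal constants -/

theorem mainTheorem1 :
    ∃ L₀ : ℝ, 0 < L₀ ∧ ∃ C : ℝ, 0 < C ∧
      ∀ (d n : ℕ), 0 < d → 3 < n →
      ∀ (μ : MeasureTheory.Measure (Fin d → ℝ)), μ (TransitionDensity.unitCube d) = 1 →
      ∀ {Ω : Type*} [MeasurableSpace Ω] (P : MeasureTheory.Measure Ω)
        [MeasureTheory.IsProbabilityMeasure P]
        (s : TransitionDensity.Pair d → ℝ) (X : ℕ → Ω → (Fin d → ℝ)),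
        TransitionDensity.IsMarkovChain P μ s X →
      ∀ (L : ℝ), L₀ ≤ L → ∀ (ℓ : ℕ∞), 1 ≤ ℓ →
      ∀ (mhat : Ω → Finset (Set (TransitionDensity.Pair d))),
        TransitionDensity.IsSelected μ n L ℓ X mhat →
      MeasureTheory.Integrable (fun ω =>
          TransitionDensity.hellingerSq μ n (fun i => X i ω)
            ((TransitionDensity.unitSquare d).indicator s)
            (TransitionDensity.histogramEstimator μ n (fun i => X i ω) (mhat ω))) P ∧
      C * ∫ ω, TransitionDensity.hellingerSq μ n (fun i => X i ω)
            ((TransitionDensity.unitSquare d).indicator s)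
            (TransitionDensity.histogramEstimator μ n (fun i => X i ω) (mhat ω)) ∂P
        ≤ ⨅ m : TransitionDensity.partitions d ℓ,
            ((∫ ω, TransitionDensity.hellingerSqDist μ n (fun i => X i ω)
                ((TransitionDensity.unitSquare d).indicator s)
                (TransitionDensity.histograms m.1) ∂P)
              + TransitionDensity.pen L n m.1) := by
  refine ⟨1000, by norm_num, 1 / 961, by norm_num, ?_⟩
  intro d n hd hn μ hμ Ω _ P _ s X hX L hL ℓ _ mhat hsel
  -- Finiteness of μ is known on the unit cube only; outside it μ is arbitrary, which is why all
  -- cell integrals are taken over the cube.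
  have : MeasureTheory.IsFiniteMeasure (μ.restrict (TransitionDensity.unitCube d)) :=
    ⟨by rw [MeasureTheory.Measure.restrict_apply_univ, hμ]; exact ENNReal.one_lt_top⟩
  refine ⟨hsel.integrable_hellingerSq hX, ?_⟩
  have : Nonempty (TransitionDensity.partitions d ℓ) :=
    ⟨⟨_, TransitionDensity.singleton_mem_partitions d ℓ⟩⟩
  refine le_ciInf fun m => ?_
  have := hsel.integral_hellingerSq_le hX hd hn hL m.2
  linarith
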